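/- Let $M$ be a closed (compact, without boundary, not necessarily connected) smooth $m$-dimensional manifold, let $n\ge 0$ and $k\ge 2$ be integers, and let $F:M\times[0,1]\to\mathbb R^n$ be a smooth map such that every $F_t=F(\cdot,t):M\to\mathbb R^n$ is a smooth embedding. For an embedding $f:M\to\mathbb R^n$ and $j\ge 2$, a closed billiard trajectory with $j$ vertices is a tuple $(x_i)_{i\in\mathbb Z/j}$ of points of $M$ with $x_i\ne x_{i+1}$ for all $i$, satisfying the reflection law $$\frac{f(x_i)-f(x_{i+1})}{\|f(x_i)-f(x_{i+1})\|}-\frac{f(x_{i-1})-f(x_i)}{\|f(x_{i-1})-f(x_i)\|}\ \perp\ df_{x_i}(T_{x_i}M)\qquad (i\in\mathbb Z/j).$$ Let $l_j(x)=\sum_{i\in\mathbb Z/j}\|f(x_i)-f(x_{i+1})\|$ on $M^{j}$. Call $f$ generic (up to $k$) if for every $2\le j\le k$ every critical point of $l_j$ with $x_i\neq x_{i+1}$ for all $i$ is nondegenerate, i.e. the Hessian of $l_j$ there is a nondegenerate bilinear form. Suppose that $F_t$ is generic up to $k$ for every $t\in[0,1]$. Then for every $t\in[0,1]$ the number of closed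 billiard trajectories of $F_t$ with $k$ vertices is finite, and it does not depend on $t$. This holds both when trajectories are counted as labelled tuples $(x_i)_{i\in\mathbb Z/k}$ and when they are counted up to the action of the dihedral group $D_k$ (rotations and reversals of the labels). -/

import Mathlib

open scoped Manifold ContDiff

noncomputable section

namespace Billiard

section Polygons

variable {n m : ℕ} {M : Type*} [TopologicalSpace M] [ChartedSpace (EuclideanSpace ℝ (Fin m)) M]

/-- The unit vector pointing from `q` to `p`, i.e. `(p - q) / ‖p - q‖`. -/
def direction (p q : EuclideanSpace ℝ (Fin n)) : EuclideanSpace ℝ (Fin n) :=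
  ‖p - q‖⁻¹ • (p - q)

/-- A closed billiard trajectory with `k` vertices for the embedding `f : M → ℝⁿ`: consecutive
vertices are distinct (indices are taken in `ℤ/k`), and at each vertex the reflection law holds,
that is, the difference of the unit vectors of the two adjacent edges is orthogonal to the tangent
space of `f(M)`. -/
def IsClosedTrajectory (f : M → EuclideanSpace ℝ (Fin n)) {k : ℕ} (x : ZMod k → M) : Prop :=
  (∀ i, x i ≠ x (i + 1)) ∧
    ∀ i, ∀ v : TangentSpace (𝓡 m) (x i),
      inner ℝ (direction (f (x i)) (f (x (i + 1))) - direction (f (x (i - 1))) (f (x i)))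
        (mfderiv (𝓡 m) 𝓘(ℝ, EuclideanSpace ℝ (Fin n)) f (x i) v :
          EuclideanSpace ℝ (Fin n)) = 0

/-- The length function `l_k` on `M^k`: the perimeter of the closed polygon. -/
def length (f : M → EuclideanSpace ℝ (Fin n)) {k : ℕ} [NeZero k] (x : ZMod k → M) : ℝ :=
  ∑ i, ‖f (x i) - f (x (i + 1))‖

/-- The length function `l_k` written in the product chart of `M^k` centred at `x`. -/
def lengthInChart (f : M → EuclideanSpace ℝ (Fin n)) {k : ℕ} [NeZero k] (x : ZMod k → M)
    (u : ZMod k → EuclideanSpace ℝ (Fin m)) : ℝ :=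
  length f fun i => (extChartAt (𝓡 m) (x i)).symm (u i)

/-- The coordinates of `x` in the product chart of `M^k` centred at `x`. -/
def coords {k : ℕ} (x : ZMod k → M) : ZMod k → EuclideanSpace ℝ (Fin m) :=
  fun i => extChartAt (𝓡 m) (x i) (x i)

/-- `x` is a critical point of `l_k`. It is meant for polygons whose consecutive vertices are
distinct; `l_k` is smooth near those. -/
def IsCriticalPoint (f : M → EuclideanSpace ℝ (Fin n)) {k : ℕ} [NeZero k]
    (x : ZMod k → M) : Prop :=
  fderiv ℝ (lengthInChart (m := m) f x) (coords x) = 0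

/-- The Hessian of `l_k` at `x`, in the product chart, is a nondegenerate bilinear form. -/
def HasNondegenerateHessian (f : M → EuclideanSpace ℝ (Fin n)) {k : ℕ} [NeZero k]
    (x : ZMod k → M) : Prop :=
  ∀ v : ZMod k → EuclideanSpace ℝ (Fin m),
    (∀ w, fderiv ℝ (fderiv ℝ (lengthInChart (m := m) f x)) (coords x) v w = 0) → v = 0

/-- All critical points of `l_k` with distinct consecutive vertices are nondegenerate. -/
def LengthIsMorse (f : M → EuclideanSpace ℝ (Fin n)) (k : ℕ) [NeZero k] : Prop :=
  ∀ x : ZMod k → M, (∀ i, x i ≠ x (i + 1)) →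
    IsCriticalPoint (m := m) f x → HasNondegenerateHessian (m := m) f x

/-- Genericity of `f` for polygons with at most `k` vertices. -/
def IsGenericUpTo (f : M → EuclideanSpace ℝ (Fin n)) (k : ℕ) : Prop :=
  ∀ (j : ℕ) [NeZero j], 2 ≤ j → j ≤ k → LengthIsMorse (m := m) f j

/-- The set of closed billiard trajectories with `k` vertices, as labelled `k`-tuples. -/
def trajectories (f : M → EuclideanSpace ℝ (Fin n)) (k : ℕ) : Set (ZMod k → M) :=
  {x | IsClosedTrajectory (m := m) f x}

end Polygons

/-- Two labelled polygons are equivalent if they differ by an element of the dihedral group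
`D_k`, i.e. by a rotation or a reflection of the labels. -/
def dihedralSetoid (k : ℕ) (M : Type*) : Setoid (ZMod k → M) where
  r x y := ∃ c : ZMod k, (∀ i, y i = x (c + i)) ∨ (∀ i, y i = x (c - i))
  iseqv :=
    { refl := fun x => ⟨0, Or.inl fun i => by simp⟩
      symm := by
        rintro x y ⟨c, h | h⟩
        · exact ⟨-c, Or.inl fun i => by rw [h]; congr 1; ring⟩
        · exact ⟨c, Or.inr fun i => by rw [h]; congr 1; ring⟩
      trans := by
        rintro x y z ⟨c, h | h⟩ ⟨d, h' | h'⟩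
        · exact ⟨c + d, Or.inl fun i => by rw [h', h]; congr 1; ring⟩
        · exact ⟨c + d, Or.inr fun i => by rw [h', h]; congr 1; ring⟩
        · exact ⟨c - d, Or.inr fun i => by rw [h', h]; congr 1; ring⟩
        · exact ⟨c - d, Or.inl fun i => by rw [h', h]; congr 1; ring⟩ }

/-- The closed billiard trajectories with `k` vertices, up to the dihedral group: the choice of
the initial vertex and of the direction of travel is forgotten. -/
def unlabelledTrajectories {n m : ℕ} {M : Type*} [TopologicalSpace M]
    [ChartedSpace (EuclideanSpace ℝ (Fin m)) M] (f : M → EuclideanSpace ℝ (Fin n)) (k : ℕ) :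
    Set (Quotient (dihedralSetoid k M)) :=
  Quotient.mk (dihedralSetoid k M) '' trajectories (m := m) f k

end Billiard

end

section

open Set Filter Topology Metric
open scoped NNReal

noncomputable section

namespace Billiard

/-! ### Counting the points of a family of fibres -/

section Counting

variable {X I : Type*} [TopologicalSpace X] [TopologicalSpace I] {T : I → Set X}

/-! In product charts the trajectories are the zeros of the derivative of the length function
(`fderiv_lengthInChart_eq_zero_iff`), and the derivative of that map is the Hessian. Nondegeneracy
thus makes each trajectory persist, uniquely in a fixed neighbourhood, for nearby parameters
(`eventually_nonempty_trajectories`, `eventually_subsingleton_trajectories`). If the set of all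
pairs (trajectory, parameter) is also closed, compactness of `M^k` prevents trajectories from
appearing elsewhere. Nearby fibres are then in bijection, compatibly with relabelling, and both
counts are locally constant on the connected interval (`ncard_fibre_eq`).

The substance is closedness (`isClosed_trajectories`), since edges could shrink to points in a
limit. The limit polygon is recorded with limits `e i` of the unit edge directions
(`IsLimitPolygon`). Along a collapsed edge `e i` is tangent, because secants of immersions converge
to tangents; the reflection law makes `e i - e (i - 1)` normal, so the unit vectors `e i` and `e (i
- 1)` agree. The limit thus passes straight through that vertex, tangentially. Deleting collapsed
edges one at a time preserves the presence of such a vertex and ends with a genuine trajectory with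
at most `k` vertices. Sliding that vertex along its edges gives a kernel vector of the Hessian
(`hessian_single_eq_zero`), contrary to genericity; this is why genericity is required for every `j
≤ k`. If all edges collapse, all `e i` coincide, which is impossible for limits of closed polygons.
-/

theorem finite_fibre [CompactSpace X] (hclosed : IsClosed {p : X × I | p.1 ∈ T p.2}) (t : I)
    (huniq : ∀ x ∈ T t, ∃ U ∈ 𝓝 x, (U ∩ T t).Subsingleton) : (T t).Finite := by
  have hc : IsCompact (T t) :=
    (hclosed.preimage (f := fun x : X => (x, t)) (by fun_prop)).isCompact
  choose! U hU hsub using huniq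
  obtain ⟨s, hs, hcov⟩ := hc.elim_nhds_subcover U hU
  refine (s.finite_toSet.biUnion fun x hx => (hsub x (hs x hx)).finite).subset fun y hy => ?_
  obtain ⟨x, hx, hyx⟩ := mem_iUnion₂.1 (hcov hy)
  exact mem_biUnion hx ⟨hyx, hy⟩

/-- Tube lemma: the complement of `U` is compact and the closed family misses it over `t₀`. -/
theorem eventually_fibre_subset [CompactSpace X]
    (hclosed : IsClosed {p : X × I | p.1 ∈ T p.2}) {t₀ : I} {U : Set X} (hU : IsOpen U)
    (hsub : T t₀ ⊆ U) : ∀ᶠ t in 𝓝 t₀, T t ⊆ U := by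
  have hc : IsCompact Uᶜ := hU.isClosed_compl.isCompact
  have hT : IsClosed {p : I × X | p.2 ∈ T p.1} := hclosed.preimage continuous_swap
  have : ∀ᶠ t in 𝓝 t₀, ∀ x ∈ Uᶜ, (t, x) ∈ {p : I × X | p.2 ∈ T p.1}ᶜ :=
    hc.eventually_forall_of_forall_eventually fun x hx =>
      hT.isOpen_compl.mem_nhds fun h => hx (hsub h)
  filter_upwards [this] with t ht x hx
  by_contra h
  exact ht x h hx

/-- If the fibres of a closed family over `I` persist locally and uniquely, then nearby fibres are
in bijection, compatibly with a finite family of continuous symmetries. -/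
theorem eventually_bijOn_fibres [T2Space X] [CompactSpace X] {ι : Type*} [Finite ι]
    (σ : ι → X → X) (hσ : ∀ g, Continuous (σ g)) (hσT : ∀ g t x, x ∈ T t → σ g x ∈ T t)
    (hclosed : IsClosed {p : X × I | p.1 ∈ T p.2}) (t₀ : I)
    (huniq : ∀ x ∈ T t₀, ∃ U ∈ 𝓝 x, ∀ᶠ t in 𝓝 t₀, (U ∩ T t).Subsingleton)
    (hex : ∀ x ∈ T t₀, ∀ U ∈ 𝓝 x, ∀ᶠ t in 𝓝 t₀, (U ∩ T t).Nonempty) :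
    ∀ᶠ t in 𝓝 t₀, ∃ φ : X → X, BijOn φ (T t₀) (T t) ∧
      ∀ g, ∀ x ∈ T t₀, φ (σ g x) = σ g (φ x) := by
  have hfin : (T t₀).Finite := finite_fibre hclosed t₀ fun x hx =>
    let ⟨U, hU, h⟩ := huniq x hx
    ⟨U, hU, h.self_of_nhds⟩
  obtain ⟨D, hD, hdisj⟩ := hfin.t2_separation
  choose! N hN hNsub using huniq
  set U : X → Set X := fun x => D x ∩ interior (N x) with hUdef
  have hUo : ∀ x, IsOpen (U x) := fun x => (hD x).2.inter isOpen_interior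
  have hUx : ∀ x ∈ T t₀, x ∈ U x := fun x hx =>
    ⟨(hD x).1, mem_interior_iff_mem_nhds.2 (hN x hx)⟩
  -- Points of `W x` have all their symmetric images in the matching sets `U (σ g x)`. Choosing `φ
  -- x` in `W x` therefore makes `φ` equivariant by uniqueness alone.
  set W : X → Set X := fun x => U x ∩ ⋂ g, σ g ⁻¹' U (σ g x)
  have hW : ∀ x ∈ T t₀, W x ∈ 𝓝 x := fun x hx =>
    inter_mem ((hUo x).mem_nhds (hUx x hx)) <| iInter_mem.2 fun g =>
      (hσ g).continuousAt.preimage_mem_nhds ((hUo _).mem_nhds (hUx _ (hσT g _ _ hx)))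
  have h1 : ∀ᶠ t in 𝓝 t₀, ∀ x ∈ T t₀, (N x ∩ T t).Subsingleton :=
    (eventually_all_finite hfin).2 hNsub
  have h2 : ∀ᶠ t in 𝓝 t₀, ∀ x ∈ T t₀, (W x ∩ T t).Nonempty :=
    (eventually_all_finite hfin).2 fun x hx => hex x hx _ (hW x hx)
  have h3 : ∀ᶠ t in 𝓝 t₀, T t ⊆ ⋃ x ∈ T t₀, U x :=
    eventually_fibre_subset hclosed (isOpen_biUnion fun x _ => hUo x)
      fun x hx => mem_biUnion hx (hUx x hx)
  filter_upwards [h1, h2, h3] with t h1 h2 h3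
  choose! φ hφ using h2
  have huniq' : ∀ x ∈ T t₀, ∀ y ∈ U x, y ∈ T t → y = φ x := fun x hx y hy hyt =>
    h1 x hx ⟨interior_subset hy.2, hyt⟩ ⟨interior_subset (hφ x hx).1.1.2, (hφ x hx).2⟩
  refine ⟨φ, ⟨fun x hx => (hφ x hx).2, fun x hx y hy hxy => ?_, fun y hy => ?_⟩,
    fun g x hx => ?_⟩
  · by_contra hne
    refine (hdisj hx hy hne).le_bot ⟨(hφ x hx).1.1.1, ?_⟩
    rw [hxy]
    exact (hφ y hy).1.1.1
  · obtain ⟨x, hx, hyx⟩ := mem_iUnion₂.1 (h3 hy)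
    exact ⟨x, hx, (huniq' x hx y hyx hy).symm⟩
  · exact (huniq' _ (hσT g _ _ hx) _ (mem_iInter.1 (hφ x hx).1.2 g)
      (hσT g _ _ (hφ x hx).2)).symm

/-- The cardinalities of the fibres, and of their images in the quotient by the symmetries, are
constant over a connected base. -/
theorem ncard_fibre_eq [T2Space X] [CompactSpace X] [PreconnectedSpace I] {ι : Type*} [Finite ι]
    (σ : ι → X → X) (hσ : ∀ g, Continuous (σ g)) (hσT : ∀ g t x, x ∈ T t → σ g x ∈ T t)
    (r : Setoid X) (hr : ∀ x y, r x y ↔ ∃ g, y = σ g x)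
    (hclosed : IsClosed {p : X × I | p.1 ∈ T p.2})
    (huniq : ∀ t₀, ∀ x ∈ T t₀, ∃ U ∈ 𝓝 x, ∀ᶠ t in 𝓝 t₀, (U ∩ T t).Subsingleton)
    (hex : ∀ t₀, ∀ x ∈ T t₀, ∀ U ∈ 𝓝 x, ∀ᶠ t in 𝓝 t₀, (U ∩ T t).Nonempty) (s t : I) :
    (T s).ncard = (T t).ncard ∧
      (Quotient.mk r '' T s).ncard = (Quotient.mk r '' T t).ncard := by
  suffices h : IsLocallyConstant fun t => ((T t).ncard, (Quotient.mk r '' T t).ncard) from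
    Prod.ext_iff.1 (h.apply_eq_of_preconnectedSpace s t)
  refine (IsLocallyConstant.iff_eventually_eq _).2 fun t₀ => ?_
  filter_upwards [eventually_bijOn_fibres σ hσ hσT hclosed t₀ (huniq t₀) (hex t₀)]
    with t ⟨φ, hφ, hφσ⟩
  have hrel : ∀ x ∈ T t₀, ∀ y ∈ T t₀, r (φ x) (φ y) ↔ r x y := by
    intro x hx y hy
    rw [hr, hr]
    refine exists_congr fun g => ?_
    rw [← hφσ g x hx]
    exact hφ.injOn.eq_iff hy (hσT g _ _ hx)
  refine Prod.ext (Set.BijOn.ncard_eq hφ).symm ?_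
  symm
  -- The representative of a class is arbitrary: by `hrel`, `φ` preserves and reflects the relation.
  refine Set.ncard_congr (fun q hq => Quotient.mk r (φ hq.choose)) ?_ ?_ ?_
  · intro q hq
    exact mem_image_of_mem _ (hφ.mapsTo hq.choose_spec.1)
  · intro q q' hq hq' h
    rw [← hq.choose_spec.2, ← hq'.choose_spec.2]
    exact Quotient.sound ((hrel _ hq.choose_spec.1 _ hq'.choose_spec.1).1 (Quotient.exact h))
  · rintro _ ⟨y, hy, rfl⟩
    obtain ⟨x, hx, rfl⟩ := hφ.surjOn hy
    have hq : Quotient.mk r x ∈ Quotient.mk r '' T t₀ := mem_image_of_mem _ hx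
    exact ⟨_, hq, Quotient.sound ((hrel _ hq.choose_spec.1 _ hx).2
      (Quotient.exact hq.choose_spec.2))⟩

end Counting

/-! ### Zeros of maps depending on a parameter -/

section Parameter

variable {I V W : Type*} [TopologicalSpace I] [NormedAddCommGroup V] [NormedSpace ℝ V]
  [NormedAddCommGroup W] [NormedSpace ℝ W] {G : I → V → W} {G' : I × V → V →L[ℝ] W} {t₀ : I}
  {u₀ : V}

/-- Mean value inequality on a convex ball. The radius is chosen before `t`, so one ball serves all
nearby parameters, and no differentiability in `t` is needed; endpoints of the interval require no
special treatment. -/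
theorem eventually_approximatesLinearOn
    (hG : ∀ᶠ p in 𝓝 (t₀, u₀), HasFDerivAt (G p.1) (G' p) p.2) (hG' : ContinuousAt G' (t₀, u₀))
    {c : ℝ≥0} (hc : 0 < c) : ∀ᶠ ε in 𝓝[>] (0 : ℝ), ∀ᶠ t in 𝓝 t₀,
      ApproximatesLinearOn (G t) (G' (t₀, u₀)) (closedBall u₀ ε) c := by
  have hb : ∀ᶠ p in 𝓝 (t₀, u₀), ‖G' p - G' (t₀, u₀)‖ ≤ c := by
    filter_upwards [hG'.eventually (Metric.ball_mem_nhds _ (NNReal.coe_pos.2 hc))] with p hp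
    exact (mem_ball_iff_norm.1 hp).le
  obtain ⟨P, hP, Q, hQ, hPQ⟩ := eventually_prod_iff.1 ((hG.and hb).filter_mono nhds_prod_eq.ge)
  obtain ⟨δ, hδ, hball⟩ := Metric.mem_nhds_iff.1 hQ
  filter_upwards [Ioo_mem_nhdsGT hδ] with ε hε
  filter_upwards [hP] with t ht
  intro x hx y hy
  have hsub : closedBall u₀ ε ⊆ {u | Q u} := (closedBall_subset_ball hε.2).trans hball
  exact (convex_closedBall u₀ ε).norm_image_sub_le_of_norm_hasFDerivWithin_le'
    (fun u hu => (hPQ ht (hsub hu)).1.hasFDerivWithinAt) (fun u hu => (hPQ ht (hsub hu)).2) hy hx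

variable (e : V ≃L[ℝ] W)

theorem exists_eventually_injOn
    (hG : ∀ᶠ p in 𝓝 (t₀, u₀), HasFDerivAt (G p.1) (G' p) p.2) (hG' : ContinuousAt G' (t₀, u₀))
    (he : (e : V →L[ℝ] W) = G' (t₀, u₀)) : ∃ s ∈ 𝓝 u₀, ∀ᶠ t in 𝓝 t₀, InjOn (G t) s := by
  -- On the zero space the inverse of `e` has norm `0`, so the constant below would not be positive.
  rcases subsingleton_or_nontrivial V with hV | hV
  · exact ⟨univ, univ_mem, Eventually.of_forall fun t x _ y _ _ => Subsingleton.elim _ _⟩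
  have hN : 0 < ‖(e.symm : W →L[ℝ] V)‖₊⁻¹ := inv_pos.2 e.nnnorm_symm_pos
  obtain ⟨ε, h, hε⟩ := ((eventually_approximatesLinearOn hG hG' (half_pos hN)).and
    self_mem_nhdsWithin).exists
  refine ⟨_, closedBall_mem_nhds u₀ hε, h.mono fun t ht => ?_⟩
  rw [← he] at ht
  exact ht.injOn (Or.inr (half_lt_self hN))

/-- Quantitative inverse function theorem: the image of a ball about `u₀` under `G t` contains a
ball about `G t u₀` whose radius `ρ` does not depend on `t`. That ball contains `0` as soon as `‖G t
u₀‖ < ρ`. -/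
theorem eventually_exists_zero [CompleteSpace V]
    (hG : ∀ᶠ p in 𝓝 (t₀, u₀), HasFDerivAt (G p.1) (G' p) p.2) (hG' : ContinuousAt G' (t₀, u₀))
    (he : (e : V →L[ℝ] W) = G' (t₀, u₀)) (hcont : ContinuousAt (fun t => G t u₀) t₀)
    (hzero : G t₀ u₀ = 0) {s : Set V} (hs : s ∈ 𝓝 u₀) :
    ∀ᶠ t in 𝓝 t₀, ∃ u ∈ s, G t u = 0 := by
  rcases subsingleton_or_nontrivial V with hV | hV
  · have : Subsingleton W := e.symm.toEquiv.subsingleton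
    exact Eventually.of_forall fun t => ⟨u₀, mem_of_mem_nhds hs, Subsingleton.elim _ _⟩
  have hN : 0 < ‖(e.symm : W →L[ℝ] V)‖₊⁻¹ := inv_pos.2 e.nnnorm_symm_pos
  obtain ⟨δ, hδ, hball⟩ := Metric.mem_nhds_iff.1 hs
  obtain ⟨ε, h, hε⟩ := ((eventually_approximatesLinearOn hG hG' (half_pos hN)).and
    (Ioo_mem_nhdsGT hδ)).exists
  set c : ℝ≥0 := ‖(e.symm : W →L[ℝ] V)‖₊⁻¹ / 2
  set ρ : ℝ := ((e.toNonlinearRightInverse.nnnorm : ℝ)⁻¹ - c) * ε with hρdef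
  have hρ : 0 < ρ := by
    refine mul_pos (sub_pos.2 ?_) hε.1
    exact_mod_cast half_lt_self hN
  have hsmall : ∀ᶠ t in 𝓝 t₀, ‖G t u₀‖ < ρ := by
    have := hcont.norm.eventually (gt_mem_nhds (show ‖G t₀ u₀‖ < ρ by simpa [hzero] using hρ))
    exact this
  filter_upwards [h, hsmall] with t ht hlt
  rw [← he] at ht
  obtain ⟨u, hu, hu0⟩ := ht.surjOn_closedBall_of_nonlinearRightInverse
    e.toNonlinearRightInverse hε.1.le Subset.rfl
    (show (0 : W) ∈ closedBall (G t u₀) ρ by simpa using hlt.le)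
  exact ⟨u, hball (closedBall_subset_ball hε.2 hu), hu0⟩

end Parameter

/-! ### The derivative of the length function -/

section LengthDerivative

variable {n : ℕ}

theorem hasFDerivAt_norm {x : EuclideanSpace ℝ (Fin n)} (hx : x ≠ 0) :
    HasFDerivAt (fun y : EuclideanSpace ℝ (Fin n) => ‖y‖) (innerSL ℝ (‖x‖⁻¹ • x)) x := by
  have h := (hasStrictFDerivAt_norm_sq x).hasFDerivAt.sqrt (pow_ne_zero 2 (norm_ne_zero_iff.2 hx))
  simp only [Real.sqrt_sq (norm_nonneg _)] at h
  refine h.congr_fderiv ?_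
  ext v
  have : ‖x‖ ≠ 0 := norm_ne_zero_iff.2 hx
  simp
  field_simp

theorem norm_direction {p q : EuclideanSpace ℝ (Fin n)} (h : p ≠ q) : ‖direction p q‖ = 1 := by
  rw [direction, norm_smul, norm_inv, norm_norm]
  exact inv_mul_cancel₀ (norm_ne_zero_iff.2 (sub_ne_zero.2 h))

theorem norm_direction_le (p q : EuclideanSpace ℝ (Fin n)) : ‖direction p q‖ ≤ 1 := by
  rcases eq_or_ne p q with rfl | h
  · simp [direction]
  · exact (norm_direction h).le

theorem norm_smul_direction (p q : EuclideanSpace ℝ (Fin n)) :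
    ‖p - q‖ • direction p q = p - q := by
  rcases eq_or_ne p q with rfl | h
  · simp [direction]
  · rw [direction, smul_smul, mul_inv_cancel₀ (norm_ne_zero_iff.2 (sub_ne_zero.2 h)), one_smul]

variable {V : Type*} [NormedAddCommGroup V] [NormedSpace ℝ V] {k : ℕ} [NeZero k]

theorem hasFDerivAt_sum_norm {g : ZMod k → V → EuclideanSpace ℝ (Fin n)}
    {A : ZMod k → V →L[ℝ] EuclideanSpace ℝ (Fin n)} {u : ZMod k → V}
    (hg : ∀ i, HasFDerivAt (g i) (A i) (u i)) (hne : ∀ i, g i (u i) ≠ g (i + 1) (u (i + 1))) :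
    HasFDerivAt (fun u : ZMod k → V => ∑ i, ‖g i (u i) - g (i + 1) (u (i + 1))‖)
      (∑ i, (innerSL ℝ (direction (g i (u i)) (g (i + 1) (u (i + 1))) -
        direction (g (i - 1) (u (i - 1))) (g i (u i)))).comp
          ((A i).comp (ContinuousLinearMap.proj i))) u := by
  have hp : ∀ i, HasFDerivAt (fun u : ZMod k → V => g i (u i))
      ((A i).comp (ContinuousLinearMap.proj i)) u := fun i =>
    (hg i).comp u (hasFDerivAt_apply i u)
  have hs := HasFDerivAt.fun_sum (u := Finset.univ) fun i (_ : i ∈ Finset.univ) =>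
    (hasFDerivAt_norm (sub_ne_zero.2 (hne i))).comp u ((hp i).sub (hp (i + 1)))
  refine hs.congr_fderiv ?_
  ext w
  simp only [sum_apply, ContinuousLinearMap.comp_apply,
    sub_apply, innerSL_apply_apply, inner_sub_left, inner_sub_right,
    Finset.sum_sub_distrib, ContinuousLinearMap.proj_apply]
  congr 1
  -- Summation by parts on the cycle: the contribution of each edge to its end vertex is reindexed,
  -- so that edges `i - 1` and `i` are both collected at vertex `i`.
  exact Fintype.sum_equiv (Equiv.addRight 1) _ _ fun i => by simp [direction]

theorem fderiv_sum_norm_apply {g : ZMod k → V → EuclideanSpace ℝ (Fin n)} {u : ZMod k → V}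
    (hg : ∀ i, DifferentiableAt ℝ (g i) (u i))
    (hne : ∀ i, g i (u i) ≠ g (i + 1) (u (i + 1))) (w : ZMod k → V) :
    fderiv ℝ (fun u : ZMod k → V => ∑ i, ‖g i (u i) - g (i + 1) (u (i + 1))‖) u w =
      ∑ i, inner ℝ (direction (g i (u i)) (g (i + 1) (u (i + 1))) -
        direction (g (i - 1) (u (i - 1))) (g i (u i))) (fderiv ℝ (g i) (u i) (w i)) := by
  rw [(hasFDerivAt_sum_norm (fun i => (hg i).hasFDerivAt) hne).fderiv]
  simp [inner_sub_left]

theorem fderiv_sum_norm_single {g : ZMod k → V → EuclideanSpace ℝ (Fin n)} {u : ZMod k → V}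
    (hg : ∀ i, DifferentiableAt ℝ (g i) (u i))
    (hne : ∀ i, g i (u i) ≠ g (i + 1) (u (i + 1))) (i : ZMod k) (v : V) :
    fderiv ℝ (fun u : ZMod k → V => ∑ i, ‖g i (u i) - g (i + 1) (u (i + 1))‖) u
        (Pi.single i v) =
      inner ℝ (direction (g i (u i)) (g (i + 1) (u (i + 1))) -
        direction (g (i - 1) (u (i - 1))) (g i (u i))) (fderiv ℝ (g i) (u i) v) := by
  rw [fderiv_sum_norm_apply hg hne, Finset.sum_eq_single i]
  · simp
  · intro j _ hj
    simp [Pi.single_eq_of_ne hj]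
  · simp

theorem fderiv_sum_norm_eq_zero_iff {g : ZMod k → V → EuclideanSpace ℝ (Fin n)} {u : ZMod k → V}
    (hg : ∀ i, DifferentiableAt ℝ (g i) (u i))
    (hne : ∀ i, g i (u i) ≠ g (i + 1) (u (i + 1))) :
    fderiv ℝ (fun u : ZMod k → V => ∑ i, ‖g i (u i) - g (i + 1) (u (i + 1))‖) u = 0 ↔
      ∀ i v, inner ℝ (direction (g i (u i)) (g (i + 1) (u (i + 1))) -
        direction (g (i - 1) (u (i - 1))) (g i (u i))) (fderiv ℝ (g i) (u i) v) = 0 := by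
  refine ⟨fun h i v => ?_, fun h => ?_⟩
  · rw [← fderiv_sum_norm_single hg hne, h]
    simp
  · ext w
    rw [fderiv_sum_norm_apply hg hne]
    simp [h]

theorem contDiffAt_sum_norm {g : ZMod k → V → EuclideanSpace ℝ (Fin n)} {u : ZMod k → V}
    {r : ℕ∞ω} (hg : ∀ i, ContDiffAt ℝ r (g i) (u i))
    (hne : ∀ i, g i (u i) ≠ g (i + 1) (u (i + 1))) :
    ContDiffAt ℝ r (fun u : ZMod k → V => ∑ i, ‖g i (u i) - g (i + 1) (u (i + 1))‖) u := by
  have hp : ∀ i, ContDiffAt ℝ r (fun u : ZMod k → V => g i (u i)) u := fun i =>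
    (hg i).comp u (contDiff_apply ℝ V i).contDiffAt
  exact ContDiffAt.sum fun i _ => ((hp i).sub (hp (i + 1))).norm ℝ (sub_ne_zero.2 (hne i))

/-- A vertex at which the polygon passes straight through, tangentially, gives a vector in the
kernel of the Hessian of the length function. -/
theorem hessian_single_eq_zero {g : ZMod k → V → EuclideanSpace ℝ (Fin n)} {u : ZMod k → V}
    (hg : ∀ i, ContDiffAt ℝ 2 (g i) (u i))
    (hne : ∀ i, g i (u i) ≠ g (i + 1) (u (i + 1))) (i : ZMod k) (v : V)
    (hstraight : direction (g (i - 1) (u (i - 1))) (g i (u i)) =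
      direction (g i (u i)) (g (i + 1) (u (i + 1))))
    (htan : fderiv ℝ (g i) (u i) v = direction (g i (u i)) (g (i + 1) (u (i + 1))))
    (w : ZMod k → V) :
    fderiv ℝ (fderiv ℝ fun u : ZMod k → V => ∑ i, ‖g i (u i) - g (i + 1) (u (i + 1))‖) u
      (Pi.single i v) w = 0 := by
  set l := fun u : ZMod k → V => ∑ i, ‖g i (u i) - g (i + 1) (u (i + 1))‖
  have hl : ContDiffAt ℝ 2 l u := contDiffAt_sum_norm hg hne
  have hsymm : IsSymmSndFDerivAt ℝ l u := hl.isSymmSndFDerivAt (by simp)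
  -- By symmetry it suffices to differentiate, in direction `w`, the partial derivative of the
  -- length along `v` at vertex `i`, for which there is a formula.
  rw [hsymm (Pi.single i v) w]
  have hl' : DifferentiableAt ℝ (fderiv ℝ l) u :=
    (hl.fderiv_right (m := 1) (by norm_num)).differentiableAt (by norm_num)
  have hval : fderiv ℝ (fderiv ℝ l) u w (Pi.single i v) =
      fderiv ℝ (fun u => fderiv ℝ l u (Pi.single i v)) u w := by
    rw [fderiv_clm_apply hl' (by fun_prop)]
    simp
  rw [hval]
  have hp : ∀ j, ContDiffAt ℝ 2 (fun u : ZMod k → V => g j (u j)) u := fun j =>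
    (hg j).comp u (contDiff_apply ℝ V j).contDiffAt
  let d : ZMod k → (ZMod k → V) → EuclideanSpace ℝ (Fin n) := fun j u =>
    direction (g j (u j)) (g (j + 1) (u (j + 1)))
  have hd : ∀ j, DifferentiableAt ℝ (d j) u := fun j => by
    have h1 := (hp j).sub (hp (j + 1))
    have h2 := (h1.norm ℝ (sub_ne_zero.2 (hne j))).inv
      (norm_ne_zero_iff.2 (sub_ne_zero.2 (hne j)))
    exact (h2.smul h1).differentiableAt (by norm_num)
  have hev : ∀ᶠ y in 𝓝 u, ∀ j, DifferentiableAt ℝ (g j) (y j) ∧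
      g j (y j) ≠ g (j + 1) (y (j + 1)) := by
    refine eventually_all.2 fun j => ?_
    have h1 : ∀ᶠ z in 𝓝 (u j), DifferentiableAt ℝ (g j) z :=
      ((hg j).eventually (by simp)).mono fun z hz => hz.differentiableAt (by norm_num)
    have h2 : ∀ᶠ y in 𝓝 u, g j (y j) ≠ g (j + 1) (y (j + 1)) :=
      ((hp j).continuousAt.ne_iff_eventually_ne (hp (j + 1)).continuousAt).1 (hne j)
    exact ((continuous_apply j).continuousAt.eventually h1).and h2
  have heq : (fun y => fderiv ℝ l y (Pi.single i v)) =ᶠ[𝓝 u]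
      fun y => inner ℝ (d i y - d (i - 1) y) (fderiv ℝ (g i) (y i) v) := by
    filter_upwards [hev] with y hy
    rw [fderiv_sum_norm_single (fun j => (hy j).1) (fun j => (hy j).2)]
    simp [d]
  rw [heq.fderiv_eq]
  have hA : DifferentiableAt ℝ (fun y : ZMod k → V => fderiv ℝ (g i) (y i) v) u := by
    have h1 : DifferentiableAt ℝ (fderiv ℝ (g i)) (u i) :=
      ((hg i).fderiv_right (m := 1) (by norm_num)).differentiableAt (by norm_num)
    exact (h1.comp u (differentiableAt_apply i u)).clm_apply (by fun_prop)
  rw [fderiv_inner_apply ℝ ((hd i).fun_sub (hd (i - 1))) hA]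
  have hd0 : d (i - 1) u = d i u := by simpa [d] using hstraight
  -- A unit vector field is orthogonal to its derivative.
  have horth : ∀ j, inner ℝ (d j u) (fderiv ℝ (d j) u w) = 0 := by
    intro j
    have hconst : (fun y => inner ℝ (d j y) (d j y)) =ᶠ[𝓝 u] fun _ => (1 : ℝ) := by
      filter_upwards [hev] with y hy
      rw [real_inner_self_eq_norm_sq, norm_direction (hy j).2, one_pow]
    have h := fderiv_inner_apply ℝ (hd j) (hd j) w
    rw [hconst.fderiv_eq] at h
    simp only [fderiv_fun_const, Pi.zero_apply, zero_apply] at h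
    rw [real_inner_comm (d j u)] at h
    linarith
  -- The term differentiating the tangent vector is paired with `d i u - d (i - 1) u = 0`. The other
  -- pairs the derivatives of `d i` and `d (i - 1)` with their common value, hence vanishes by
  -- `horth`.
  rw [hd0, sub_self, inner_zero_left, zero_add, fderiv_fun_sub (hd i) (hd (i - 1)), htan,
    sub_apply, inner_sub_left, real_inner_comm, horth i, real_inner_comm]
  have h2 := horth (i - 1)
  rw [hd0] at h2
  simpa [d] using h2

end LengthDerivative

/-! ### Tangent directions and charts -/

section Charts

/-- In immersion charts `f` is a linear inclusion, so projecting back yields a differentiable local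
left inverse; the chain rule does the rest. -/
theorem injective_mfderiv_of_isImmersionAt {E E' H G M N : Type*} [NormedAddCommGroup E]
    [NormedSpace ℝ E] [NormedAddCommGroup E'] [NormedSpace ℝ E'] [TopologicalSpace H]
    [TopologicalSpace G] [TopologicalSpace M] [ChartedSpace H M] [TopologicalSpace N]
    [ChartedSpace G N] {I : ModelWithCorners ℝ E H} {J : ModelWithCorners ℝ E' G}
    [I.Boundaryless] [IsManifold I ∞ M] [IsManifold J ∞ N] {f : M → N} {x : M}
    (h : Manifold.IsImmersionAt I J ∞ f x) : Function.Injective (mfderiv I J f x) := by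
  set φ := h.domChart.extend I
  set ψ := h.codChart.extend J
  have hsrc : φ.source ∈ 𝓝 x := h.domChart.extend_source_mem_nhds h.mem_domChart_source
  have hx : x ∈ φ.source := mem_of_mem_nhds hsrc
  let p : E' →L[ℝ] E :=
    (ContinuousLinearMap.fst ℝ E h.complement).comp (h.equiv.symm : E' →L[ℝ] E × h.complement)
  have hp : ∀ y ∈ φ.source, p (ψ (f y)) = φ y := fun y hy => by
    have := h.writtenInCharts (φ.map_source hy)
    simp only [Function.comp_apply] at this
    rw [φ.left_inv hy] at this
    change (h.equiv.symm (ψ (f y))).1 = φ y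
    rw [this, ContinuousLinearEquiv.symm_apply_apply]
  have hψ : MDifferentiableAt J 𝓘(ℝ, E') ψ (f x) :=
    (h.codChart.contMDiffAt_extend (n := ∞) h.codChart_mem_maximalAtlas
      h.mem_codChart_source).mdifferentiableAt (by simp)
  have hf : MDifferentiableAt I J f x := h.contMDiffAt.mdifferentiableAt (by simp)
  have hφs : MDifferentiableAt 𝓘(ℝ, E) I φ.symm (p (ψ (f x))) := by
    have h1 := contMDiffOn_extend_symm h.domChart_mem_maximalAtlas
    refine (h1.contMDiffAt ?_).mdifferentiableAt (by simp)
    rw [← h.domChart.extend_target', hp x hx]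
    exact h.domChart.isOpen_extend_target.mem_nhds (φ.map_source hx)
  have hpd : MDifferentiableAt 𝓘(ℝ, E') 𝓘(ℝ, E) p (ψ (f x)) :=
    p.differentiableAt.mdifferentiableAt
  have hQ : MDifferentiableAt J I (φ.symm ∘ p ∘ ψ) (f x) :=
    hφs.comp (f x) (hpd.comp (f x) hψ)
  have hid : (φ.symm ∘ p ∘ ψ) ∘ f =ᶠ[𝓝 x] id := by
    filter_upwards [hsrc] with y hy
    simp only [Function.comp_apply, id]
    rw [hp y hy, φ.left_inv hy]
  have hcomp := mfderiv_comp x hQ hf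
  rw [hid.mfderiv_eq, mfderiv_id] at hcomp
  intro v w hvw
  have hv := congrArg (fun A => A v) hcomp
  have hw := congrArg (fun A => A w) hcomp
  simp only [ContinuousLinearMap.comp_apply, hvw] at hv hw
  exact hv.trans hw.symm

variable {n m : ℕ} {M : Type*} [TopologicalSpace M] [ChartedSpace (EuclideanSpace ℝ (Fin m)) M]

/-- The image of the tangent space at `p` under the differential of `f`. -/
def tangentDirections (f : M → EuclideanSpace ℝ (Fin n)) (p : M) :
    Set (EuclideanSpace ℝ (Fin n)) :=
  range fun v : TangentSpace (𝓡 m) p =>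
    (mfderiv (𝓡 m) 𝓘(ℝ, EuclideanSpace ℝ (Fin n)) f p v : EuclideanSpace ℝ (Fin n))

/-- The reflection law sees the differential only through its range in Euclidean space, so it can be
checked in any chart. -/
theorem isClosedTrajectory_iff {f : M → EuclideanSpace ℝ (Fin n)} {k : ℕ} {x : ZMod k → M} :
    IsClosedTrajectory (m := m) f x ↔ (∀ i, x i ≠ x (i + 1)) ∧
      ∀ i, ∀ a ∈ tangentDirections (m := m) f (x i),
        inner ℝ (direction (f (x i)) (f (x (i + 1))) -
          direction (f (x (i - 1))) (f (x i))) a = 0 := by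
  refine and_congr Iff.rfl (forall_congr' fun i => ?_)
  exact (forall_mem_range (p := fun a => inner ℝ (direction (f (x i)) (f (x (i + 1))) -
    direction (f (x (i - 1))) (f (x i))) a = 0)).symm

variable [IsManifold (𝓡 m) ∞ M]

theorem mdifferentiableAt_extChartAt_symm {p : M} {u : EuclideanSpace ℝ (Fin m)}
    (hu : u ∈ (extChartAt (𝓡 m) p).target) :
    MDifferentiableAt 𝓘(ℝ, EuclideanSpace ℝ (Fin m)) (𝓡 m) (extChartAt (𝓡 m) p).symm u :=
  ((contMDiffOn_extChartAt_symm (n := ∞) p).contMDiffAt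
    ((isOpen_extChartAt_target p).mem_nhds hu)).mdifferentiableAt (by simp)

/-- The inverse chart has surjective differential at every point of its target, not only at the
centre. -/
theorem range_fderiv_comp_extChartAt_symm {f : M → EuclideanSpace ℝ (Fin n)} {p : M}
    {u : EuclideanSpace ℝ (Fin m)} (hu : u ∈ (extChartAt (𝓡 m) p).target)
    (hf : MDifferentiableAt (𝓡 m) 𝓘(ℝ, EuclideanSpace ℝ (Fin n)) f
      ((extChartAt (𝓡 m) p).symm u)) :
    range (fderiv ℝ (fun u => f ((extChartAt (𝓡 m) p).symm u)) u) =
      tangentDirections (m := m) f ((extChartAt (𝓡 m) p).symm u) := by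
  have : IsManifold (𝓡 m) 1 M := IsManifold.of_le (n := ∞) (by simp)
  have hsurj : Function.Surjective (mfderiv 𝓘(ℝ, EuclideanSpace ℝ (Fin m)) (𝓡 m)
      (extChartAt (𝓡 m) p).symm u) := by
    have h := isInvertible_mfderivWithin_extChartAt_symm (I := 𝓡 m) hu
    rw [ModelWithCorners.range_eq_univ, mfderivWithin_univ] at h
    exact h.surjective
  have hcomp := mfderiv_comp u hf (mdifferentiableAt_extChartAt_symm hu)
  rw [← mfderiv_eq_fderiv]
  change range (mfderiv 𝓘(ℝ, EuclideanSpace ℝ (Fin m)) 𝓘(ℝ, EuclideanSpace ℝ (Fin n))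
    (f ∘ (extChartAt (𝓡 m) p).symm) u) = _
  rw [hcomp]
  exact hsurj.range_comp _

theorem differentiableAt_comp_extChartAt_symm {f : M → EuclideanSpace ℝ (Fin n)} {p : M}
    {u : EuclideanSpace ℝ (Fin m)} (hu : u ∈ (extChartAt (𝓡 m) p).target)
    (hf : MDifferentiableAt (𝓡 m) 𝓘(ℝ, EuclideanSpace ℝ (Fin n)) f
      ((extChartAt (𝓡 m) p).symm u)) :
    DifferentiableAt ℝ (fun u => f ((extChartAt (𝓡 m) p).symm u)) u :=
  (hf.comp u (mdifferentiableAt_extChartAt_symm hu)).differentiableAt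

/-- In charts, the closed trajectories are the zeros of the derivative of the length. -/
theorem fderiv_lengthInChart_eq_zero_iff {f : M → EuclideanSpace ℝ (Fin n)}
    (hf : MDifferentiable (𝓡 m) 𝓘(ℝ, EuclideanSpace ℝ (Fin n)) f)
    (hinj : Function.Injective f) {k : ℕ} [NeZero k] (x : ZMod k → M)
    {u : ZMod k → EuclideanSpace ℝ (Fin m)}
    (hu : ∀ i, u i ∈ (extChartAt (𝓡 m) (x i)).target)
    (hne : ∀ i, (extChartAt (𝓡 m) (x i)).symm (u i) ≠
      (extChartAt (𝓡 m) (x (i + 1))).symm (u (i + 1))) :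
    fderiv ℝ (lengthInChart (m := m) f x) u = 0 ↔
      IsClosedTrajectory (m := m) f fun i => (extChartAt (𝓡 m) (x i)).symm (u i) := by
  rw [isClosedTrajectory_iff, and_iff_right hne]
  refine (fderiv_sum_norm_eq_zero_iff
    (g := fun i v => f ((extChartAt (𝓡 m) (x i)).symm v))
    (fun i => differentiableAt_comp_extChartAt_symm (hu i) (hf _))
    fun i => hinj.ne (hne i)).trans ?_
  refine forall_congr' fun i => ?_
  rw [← range_fderiv_comp_extChartAt_symm (hu i) (hf _), forall_mem_range]

theorem isCriticalPoint_iff {f : M → EuclideanSpace ℝ (Fin n)}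
    (hf : MDifferentiable (𝓡 m) 𝓘(ℝ, EuclideanSpace ℝ (Fin n)) f)
    (hinj : Function.Injective f) {k : ℕ} [NeZero k] {x : ZMod k → M}
    (hne : ∀ i, x i ≠ x (i + 1)) :
    IsCriticalPoint (m := m) f x ↔ IsClosedTrajectory (m := m) f x := by
  have h := fderiv_lengthInChart_eq_zero_iff hf hinj x (u := coords (m := m) x)
    (fun i => mem_extChartAt_target (x i)) (by simpa only [coords, extChartAt_to_inv] using hne)
  simp only [coords, extChartAt_to_inv] at h
  exact h

/-- A polygon with a vertex at which it passes straight through, tangentially, is not a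
nondegenerate critical point of the length function. -/
theorem not_lengthIsMorse {f : M → EuclideanSpace ℝ (Fin n)}
    (hf : ContMDiff (𝓡 m) 𝓘(ℝ, EuclideanSpace ℝ (Fin n)) ∞ f)
    (hinj : Function.Injective f) {k : ℕ} [NeZero k] {x : ZMod k → M}
    (hx : IsClosedTrajectory (m := m) f x) (i : ZMod k)
    (hstraight : direction (f (x (i - 1))) (f (x i)) = direction (f (x i)) (f (x (i + 1))))
    (htan : direction (f (x i)) (f (x (i + 1))) ∈ tangentDirections (m := m) f (x i)) :
    ¬ LengthIsMorse (m := m) f k := by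
  intro hmorse
  have hfd := hf.mdifferentiable (by simp)
  have hnd := hmorse x hx.1 ((isCriticalPoint_iff hfd hinj hx.1).2 hx)
  have hcoords : ∀ j, (extChartAt (𝓡 m) (x j)).symm (coords (m := m) x j) = x j := fun j =>
    extChartAt_to_inv (I := 𝓡 m) (x j)
  have hmem : ∀ j, coords (m := m) x j ∈ (extChartAt (𝓡 m) (x j)).target := fun j =>
    mem_extChartAt_target (x j)
  have hrange := range_fderiv_comp_extChartAt_symm (hmem i) (hfd _)
  rw [hcoords i] at hrange
  rw [← hrange] at htan
  obtain ⟨v, hv⟩ := htan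
  have hv0 : Pi.single i v = (0 : ZMod k → EuclideanSpace ℝ (Fin m)) := by
    refine hnd _ fun w => hessian_single_eq_zero (u := coords (m := m) x)
      (g := fun i v => f ((extChartAt (𝓡 m) (x i)).symm v)) (fun j => ?_) (fun j => ?_) i v ?_ ?_ w
    · have h1 := (contMDiffOn_extChartAt_symm (n := ∞) (x j)).contMDiffAt
        ((isOpen_extChartAt_target (I := 𝓡 m) (x j)).mem_nhds (hmem j))
      exact ((hf.contMDiffAt.comp _ h1).contDiffAt).of_le (WithTop.coe_le_coe.2 le_top)
    · simp only [hcoords]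
      exact hinj.ne (hx.1 j)
    · simp only [hcoords]
      exact hstraight
    · simp only [hcoords]
      exact hv
  -- The contradiction: the image of `v` is a unit vector.
  have hv0' : v = 0 := by simpa using hv0
  rw [hv0', map_zero] at hv
  have := norm_direction (hinj.ne (hx.1 i))
  rw [← hv, norm_zero] at this
  exact zero_ne_one this

end Charts

/-! ### Smooth dependence on the parameter -/

section Families

/-- The parameter space may have boundary, so joint smoothness of the partial derivative comes from
the manifold derivative; between vector spaces the tangent coordinates are trivial. -/
theorem contMDiffAt_partial_fderiv {H' G' N V W : Type*} [NormedAddCommGroup H']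
    [NormedSpace ℝ H'] [TopologicalSpace G'] [TopologicalSpace N] [ChartedSpace G' N]
    {J : ModelWithCorners ℝ H' G'} [IsManifold J ∞ N] [NormedAddCommGroup V] [NormedSpace ℝ V]
    [NormedAddCommGroup W] [NormedSpace ℝ W] {L : N → V → W} {p : N × V}
    (h : ContMDiffAt (J.prod 𝓘(ℝ, V)) 𝓘(ℝ, W) ∞ (fun q : N × V => L q.1 q.2) p) :
    ContMDiffAt (J.prod 𝓘(ℝ, V)) 𝓘(ℝ, V →L[ℝ] W) ∞
      (fun q : N × V => fderiv ℝ (L q.1) q.2) p := by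
  have h1 : ContMDiffAt ((J.prod 𝓘(ℝ, V)).prod 𝓘(ℝ, V)) 𝓘(ℝ, W) ∞
      (Function.uncurry fun (q : N × V) (v : V) => L q.1 v) (p, p.2) := by
    have h2 : ContMDiffAt ((J.prod 𝓘(ℝ, V)).prod 𝓘(ℝ, V)) (J.prod 𝓘(ℝ, V)) ∞
        (fun z : (N × V) × V => (z.1.1, z.2)) (p, p.2) :=
      (contMDiffAt_fst.comp _ contMDiffAt_fst).prodMk contMDiffAt_snd
    exact ContMDiffAt.comp (p, p.2) (f := fun z : (N × V) × V => (z.1.1, z.2))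
      (g := fun q : N × V => L q.1 q.2) h h2
  have h3 := ContMDiffAt.mfderiv (m := ∞) (fun (q : N × V) (v : V) => L q.1 v) Prod.snd h1
    contMDiffAt_snd (by simp)
  simp only [mfderiv_eq_fderiv] at h3
  have h4 := inTangentCoordinates_model_space (I := 𝓘(ℝ, V)) (I' := 𝓘(ℝ, W))
    Prod.snd (fun x : N × V => L x.1 x.2) (fun x => fderiv ℝ (L x.1) x.2) p
  exact h4 ▸ h3

theorem differentiableAt_slice_of_contMDiffAt {H' G' N V W : Type*} [NormedAddCommGroup H']
    [NormedSpace ℝ H'] [TopologicalSpace G'] [TopologicalSpace N] [ChartedSpace G' N]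
    {J : ModelWithCorners ℝ H' G'} [NormedAddCommGroup V] [NormedSpace ℝ V]
    [NormedAddCommGroup W] [NormedSpace ℝ W] {L : N → V → W} {p : N × V}
    (h : ContMDiffAt (J.prod 𝓘(ℝ, V)) 𝓘(ℝ, W) ∞ (fun q : N × V => L q.1 q.2) p) :
    DifferentiableAt ℝ (L p.1) p.2 := by
  have h1 : ContMDiffAt 𝓘(ℝ, V) 𝓘(ℝ, W) ∞ (L p.1) p.2 :=
    ContMDiffAt.comp (I' := J.prod 𝓘(ℝ, V)) p.2 (f := fun v : V => (p.1, v))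
      (g := fun q : N × V => L q.1 q.2) h (contMDiffAt_const.prodMk contMDiffAt_id)
  exact h1.contDiffAt.differentiableAt (by simp)

variable {n m : ℕ} {M : Type*} [TopologicalSpace M]
  [ChartedSpace (EuclideanSpace ℝ (Fin m)) M] {F : M × unitInterval → EuclideanSpace ℝ (Fin n)}

theorem contMDiff_slice
    (hF : ContMDiff ((𝓡 m).prod (𝓡∂ 1)) 𝓘(ℝ, EuclideanSpace ℝ (Fin n)) ∞ F) (t : unitInterval) :
    ContMDiff (𝓡 m) 𝓘(ℝ, EuclideanSpace ℝ (Fin n)) ∞ fun p : M => F (p, t) :=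
  hF.comp (contMDiff_id.prodMk contMDiff_const)

theorem mdifferentiable_slice
    (hF : ContMDiff ((𝓡 m).prod (𝓡∂ 1)) 𝓘(ℝ, EuclideanSpace ℝ (Fin n)) ∞ F) (t : unitInterval) :
    MDifferentiable (𝓡 m) 𝓘(ℝ, EuclideanSpace ℝ (Fin n)) fun p : M => F (p, t) :=
  (contMDiff_slice hF t).mdifferentiable (by simp)

variable [IsManifold (𝓡 m) ∞ M]

theorem contMDiffAt_comp_extChartAt_symm
    (hF : ContMDiff ((𝓡 m).prod (𝓡∂ 1)) 𝓘(ℝ, EuclideanSpace ℝ (Fin n)) ∞ F)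
    {p : M} {q : unitInterval × EuclideanSpace ℝ (Fin m)}
    (hq : q.2 ∈ (extChartAt (𝓡 m) p).target) :
    ContMDiffAt ((𝓡∂ 1).prod 𝓘(ℝ, EuclideanSpace ℝ (Fin m)))
      𝓘(ℝ, EuclideanSpace ℝ (Fin n)) ∞
      (fun q : unitInterval × EuclideanSpace ℝ (Fin m) =>
        F ((extChartAt (𝓡 m) p).symm q.2, q.1)) q := by
  have h1 := (contMDiffOn_extChartAt_symm (n := ∞) p).contMDiffAt
    ((isOpen_extChartAt_target (I := 𝓡 m) p).mem_nhds hq)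
  exact hF.contMDiffAt.comp q ((h1.comp q contMDiffAt_snd).prodMk contMDiffAt_fst)

theorem contMDiffAt_lengthInChart
    (hF : ContMDiff ((𝓡 m).prod (𝓡∂ 1)) 𝓘(ℝ, EuclideanSpace ℝ (Fin n)) ∞ F)
    {k : ℕ} [NeZero k] (x : ZMod k → M)
    {q : unitInterval × (ZMod k → EuclideanSpace ℝ (Fin m))}
    (hq : ∀ i, q.2 i ∈ (extChartAt (𝓡 m) (x i)).target)
    (hne : ∀ i, F ((extChartAt (𝓡 m) (x i)).symm (q.2 i), q.1) ≠
      F ((extChartAt (𝓡 m) (x (i + 1))).symm (q.2 (i + 1)), q.1)) :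
    ContMDiffAt ((𝓡∂ 1).prod 𝓘(ℝ, ZMod k → EuclideanSpace ℝ (Fin m))) 𝓘(ℝ, ℝ) ∞
      (fun q : unitInterval × (ZMod k → EuclideanSpace ℝ (Fin m)) =>
        lengthInChart (m := m) (fun p => F (p, q.1)) x q.2) q := by
  have hg : ∀ i, ContMDiffAt ((𝓡∂ 1).prod 𝓘(ℝ, ZMod k → EuclideanSpace ℝ (Fin m)))
      𝓘(ℝ, EuclideanSpace ℝ (Fin n)) ∞
      (fun q : unitInterval × (ZMod k → EuclideanSpace ℝ (Fin m)) =>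
        F ((extChartAt (𝓡 m) (x i)).symm (q.2 i), q.1)) q := by
    intro i
    have h1 : ContMDiffAt ((𝓡∂ 1).prod 𝓘(ℝ, ZMod k → EuclideanSpace ℝ (Fin m)))
        ((𝓡∂ 1).prod 𝓘(ℝ, EuclideanSpace ℝ (Fin m))) ∞
        (fun q : unitInterval × (ZMod k → EuclideanSpace ℝ (Fin m)) => (q.1, q.2 i)) q :=
      contMDiffAt_fst.prodMk (contMDiffAt_pi_space.1 contMDiffAt_snd i)
    exact ContMDiffAt.comp q
      (f := fun q : unitInterval × (ZMod k → EuclideanSpace ℝ (Fin m)) => (q.1, q.2 i))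
      (contMDiffAt_comp_extChartAt_symm hF (hq i)) h1
  refine contMDiffAt_finsetSum fun i _ => ?_
  have h := (hg i).sub (hg (i + 1))
  exact ContMDiffAt.comp q (g := fun y : EuclideanSpace ℝ (Fin n) => ‖y‖)
    (contDiffAt_norm ℝ (sub_ne_zero.2 (hne i))).contMDiffAt h

/-- The derivative of the length function in a chart, as a family of maps. -/
def lengthDeriv (F : M × unitInterval → EuclideanSpace ℝ (Fin n)) {k : ℕ} [NeZero k]
    (x : ZMod k → M) (t : unitInterval) (u : ZMod k → EuclideanSpace ℝ (Fin m)) :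
    (ZMod k → EuclideanSpace ℝ (Fin m)) →L[ℝ] ℝ :=
  fderiv ℝ (lengthInChart (m := m) (fun p => F (p, t)) x) u

variable {k : ℕ} [NeZero k] {x : ZMod k → M} {t₀ : unitInterval}

theorem eventually_noncollapsed_in_chart
    (hF : ContMDiff ((𝓡 m).prod (𝓡∂ 1)) 𝓘(ℝ, EuclideanSpace ℝ (Fin n)) ∞ F)
    (hne : ∀ i, F (x i, t₀) ≠ F (x (i + 1), t₀)) :
    ∀ᶠ q in 𝓝 (t₀, coords (m := m) x), ∀ i,
      q.2 i ∈ (extChartAt (𝓡 m) (x i)).target ∧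
        F ((extChartAt (𝓡 m) (x i)).symm (q.2 i), q.1) ≠
          F ((extChartAt (𝓡 m) (x (i + 1))).symm (q.2 (i + 1)), q.1) := by
  refine eventually_all.2 fun i => ?_
  have hc : ∀ j, ContinuousAt (fun q : unitInterval × (ZMod k → EuclideanSpace ℝ (Fin m)) =>
      F ((extChartAt (𝓡 m) (x j)).symm (q.2 j), q.1)) (t₀, coords (m := m) x) := by
    intro j
    have h1 := (contMDiffAt_comp_extChartAt_symm hF (p := x j) (q := (t₀, coords (m := m) x j))
      (mem_extChartAt_target (x j))).continuousAt
    exact ContinuousAt.comp (x := (t₀, coords (m := m) x))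
      (f := fun q : unitInterval × (ZMod k → EuclideanSpace ℝ (Fin m)) => (q.1, q.2 j)) h1
      (by fun_prop)
  refine Eventually.and ?_ (((hc i).ne_iff_eventually_ne (hc (i + 1))).1 ?_)
  · have h1 : ContinuousAt (fun q : unitInterval × (ZMod k → EuclideanSpace ℝ (Fin m)) => q.2 i)
      (t₀, coords (m := m) x) := by fun_prop
    exact h1.eventually ((isOpen_extChartAt_target (x i)).mem_nhds (mem_extChartAt_target (x i)))
  · simpa only [coords, extChartAt_to_inv] using hne i

/-- These are the hypotheses of the parameter lemmas for the equation `lengthDeriv F x t u = 0`. -/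
theorem hasFDerivAt_lengthDeriv
    (hF : ContMDiff ((𝓡 m).prod (𝓡∂ 1)) 𝓘(ℝ, EuclideanSpace ℝ (Fin n)) ∞ F)
    (hne : ∀ i, F (x i, t₀) ≠ F (x (i + 1), t₀)) :
    (∀ᶠ q in 𝓝 (t₀, coords (m := m) x), HasFDerivAt (lengthDeriv F x q.1)
      (fderiv ℝ (lengthDeriv F x q.1) q.2) q.2) ∧
    ContinuousAt (fun q : unitInterval × (ZMod k → EuclideanSpace ℝ (Fin m)) =>
      fderiv ℝ (lengthDeriv F x q.1) q.2) (t₀, coords (m := m) x) ∧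
    ContinuousAt (fun t => lengthDeriv F x t (coords (m := m) x)) t₀ := by
  have hsmooth : ∀ᶠ q in 𝓝 (t₀, coords (m := m) x),
      ContMDiffAt ((𝓡∂ 1).prod 𝓘(ℝ, ZMod k → EuclideanSpace ℝ (Fin m)))
        𝓘(ℝ, (ZMod k → EuclideanSpace ℝ (Fin m)) →L[ℝ] ℝ) ∞
        (fun q : unitInterval × (ZMod k → EuclideanSpace ℝ (Fin m)) =>
          lengthDeriv F x q.1 q.2) q := by
    filter_upwards [eventually_noncollapsed_in_chart hF hne] with q hq
    exact contMDiffAt_partial_fderiv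
      (L := fun t u => lengthInChart (m := m) (fun p => F (p, t)) x u)
      (contMDiffAt_lengthInChart hF x (fun i => (hq i).1) fun i => (hq i).2)
  have h0 := hsmooth.self_of_nhds
  refine ⟨hsmooth.mono fun q hq => (differentiableAt_slice_of_contMDiffAt hq).hasFDerivAt,
    (contMDiffAt_partial_fderiv h0).continuousAt, ?_⟩
  exact ContinuousAt.comp (f := fun t => (t, coords (m := m) x)) h0.continuousAt (by fun_prop)

theorem exists_continuousLinearEquiv_dual {V : Type*} [NormedAddCommGroup V] [NormedSpace ℝ V]
    [FiniteDimensional ℝ V] (B : V →L[ℝ] V →L[ℝ] ℝ) (hB : ∀ v, (∀ w, B v w = 0) → v = 0) :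
    ∃ e : V ≃L[ℝ] (V →L[ℝ] ℝ), (e : V →L[ℝ] V →L[ℝ] ℝ) = B := by
  have hinj : Function.Injective (B : V →ₗ[ℝ] V →L[ℝ] ℝ) :=
    (injective_iff_map_eq_zero _).2 fun v hv => hB v fun w => by
      have := congrArg (fun A : V →L[ℝ] ℝ => A w) hv
      simpa using this
  have hdim : Module.finrank ℝ V = Module.finrank ℝ (V →L[ℝ] ℝ) := by
    rw [← (LinearMap.toContinuousLinearMap (𝕜 := ℝ) (E := V) (F' := ℝ)).finrank_eq]
    exact Subspace.dual_finrank_eq.symm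
  refine ⟨(LinearMap.linearEquivOfInjective (B : V →ₗ[ℝ] V →L[ℝ] ℝ) hinj
    hdim).toContinuousLinearEquiv, ?_⟩
  ext v w
  rfl

theorem eventually_subsingleton_trajectories
    (hF : ContMDiff ((𝓡 m).prod (𝓡∂ 1)) 𝓘(ℝ, EuclideanSpace ℝ (Fin n)) ∞ F)
    (hinj : ∀ t, Function.Injective fun p : M => F (p, t)) (hx : ∀ i, x i ≠ x (i + 1))
    (hnd : HasNondegenerateHessian (m := m) (fun p => F (p, t₀)) x) :
    ∃ U ∈ 𝓝 x, ∀ᶠ t in 𝓝 t₀,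
      (U ∩ trajectories (m := m) (fun p => F (p, t)) k).Subsingleton := by
  obtain ⟨h1, h2, -⟩ := hasFDerivAt_lengthDeriv hF fun i => (hinj t₀).ne (hx i)
  obtain ⟨e, he⟩ := exists_continuousLinearEquiv_dual _ hnd
  obtain ⟨s, hs, hinjOn⟩ := exists_eventually_injOn e h1 h2 he
  let φ : (ZMod k → M) → ZMod k → EuclideanSpace ℝ (Fin m) := fun y i =>
    extChartAt (𝓡 m) (x i) (y i)
  have hφ : ContinuousAt φ x := continuousAt_pi.2 fun i =>
    ContinuousAt.comp (f := fun y : ZMod k → M => y i) (continuousAt_extChartAt (x i))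
      (continuous_apply i).continuousAt
  have hsrc : ∀ᶠ y in 𝓝 x, ∀ i, y i ∈ (extChartAt (𝓡 m) (x i)).source :=
    eventually_all.2 fun i =>
      (continuous_apply i).continuousAt.eventually (extChartAt_source_mem_nhds (x i))
  refine ⟨_, inter_mem hsrc (hφ.preimage_mem_nhds hs), ?_⟩
  filter_upwards [hinjOn] with t ht
  have hzero : ∀ y, (∀ i, y i ∈ (extChartAt (𝓡 m) (x i)).source) →
      y ∈ trajectories (m := m) (fun p => F (p, t)) k → lengthDeriv F x t (φ y) = 0 := by
    intro y hy hyt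
    have hinv : ∀ i, (extChartAt (𝓡 m) (x i)).symm (extChartAt (𝓡 m) (x i) (y i)) = y i := fun i =>
      (extChartAt (𝓡 m) (x i)).left_inv (hy i)
    refine (fderiv_lengthInChart_eq_zero_iff (mdifferentiable_slice hF t) (hinj t) x
      (fun i => (extChartAt (𝓡 m) (x i)).map_source (hy i)) ?_).2 ?_
    · simpa only [φ, hinv] using hyt.1
    · simp only [hinv]
      exact hyt
  rintro y ⟨⟨hy, hys⟩, hyt⟩ z ⟨⟨hz, hzs⟩, hzt⟩
  have hyz := ht hys hzs ((hzero y hy hyt).trans (hzero z hz hzt).symm)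
  ext i
  exact (extChartAt (𝓡 m) (x i)).injOn (hy i) (hz i) (congrFun hyz i)

theorem eventually_nonempty_trajectories
    (hF : ContMDiff ((𝓡 m).prod (𝓡∂ 1)) 𝓘(ℝ, EuclideanSpace ℝ (Fin n)) ∞ F)
    (hinj : ∀ t, Function.Injective fun p : M => F (p, t))
    (hx : x ∈ trajectories (m := m) (fun p => F (p, t₀)) k)
    (hnd : HasNondegenerateHessian (m := m) (fun p => F (p, t₀)) x) {U : Set (ZMod k → M)}
    (hU : U ∈ 𝓝 x) :
    ∀ᶠ t in 𝓝 t₀, (U ∩ trajectories (m := m) (fun p => F (p, t)) k).Nonempty := by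
  have hne : ∀ i, F (x i, t₀) ≠ F (x (i + 1), t₀) := fun i => (hinj t₀).ne (hx.1 i)
  obtain ⟨h1, h2, h3⟩ := hasFDerivAt_lengthDeriv hF hne
  obtain ⟨e, he⟩ := exists_continuousLinearEquiv_dual _ hnd
  have hzero : lengthDeriv F x t₀ (coords (m := m) x) = 0 :=
    (isCriticalPoint_iff (mdifferentiable_slice hF t₀) (hinj t₀) hx.1).2 hx
  let ψ : (ZMod k → EuclideanSpace ℝ (Fin m)) → ZMod k → M := fun u i =>
    (extChartAt (𝓡 m) (x i)).symm (u i)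
  have hψ : ContinuousAt ψ (coords (m := m) x) := continuousAt_pi.2 fun i =>
    ContinuousAt.comp (f := fun u : ZMod k → EuclideanSpace ℝ (Fin m) => u i)
      (continuousAt_extChartAt_symm (x i)) (continuous_apply i).continuousAt
  have hψx : ψ (coords (m := m) x) = x := funext fun i => extChartAt_to_inv (I := 𝓡 m) (x i)
  obtain ⟨P, hP, Q, hQ, hPQ⟩ := eventually_prod_iff.1
    ((eventually_noncollapsed_in_chart hF hne).filter_mono nhds_prod_eq.ge)
  -- Intersecting with `Q` keeps the zero inside the chart targets and its edges nonzero, so that it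
  -- is a trajectory.
  have hs : {u | Q u} ∩ ψ ⁻¹' U ∈ 𝓝 (coords (m := m) x) :=
    inter_mem hQ (hψ.preimage_mem_nhds (by rwa [hψx]))
  filter_upwards [hP, eventually_exists_zero e h1 h2 he h3 hzero hs] with t ht hex
  obtain ⟨u, ⟨hQu, hUu⟩, hu⟩ := hex
  have hgood := hPQ ht hQu
  refine ⟨ψ u, hUu, (fderiv_lengthInChart_eq_zero_iff (mdifferentiable_slice hF t) (hinj t) x
    (fun i => (hgood i).1) fun i h => (hgood i).2 ?_).1 hu⟩
  simp only [h]

end Families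

/-! ### Limits of closed trajectories -/

section LimitPolygons

variable {n m : ℕ} {M : Type*} [TopologicalSpace M] [ChartedSpace (EuclideanSpace ℝ (Fin m)) M]
  {f : M → EuclideanSpace ℝ (Fin n)}

/-- A closed polygon, possibly with collapsed edges, together with directions of its edges such
that the reflection law holds and the directions of the collapsed edges are tangent. -/
structure IsLimitPolygon (f : M → EuclideanSpace ℝ (Fin n)) {k : ℕ} (x : ZMod k → M)
    (e : ZMod k → EuclideanSpace ℝ (Fin n)) : Prop where
  norm_eq_one : ∀ i, ‖e i‖ = 1
  eq_direction : ∀ i, x i ≠ x (i + 1) → e i = direction (f (x i)) (f (x (i + 1)))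
  mem_tangentDirections : ∀ i, x i = x (i + 1) → e i ∈ tangentDirections (m := m) f (x i)
  reflection : ∀ i, ∀ a ∈ tangentDirections (m := m) f (x i), inner ℝ (e i - e (i - 1)) a = 0

/-- Equality case of Cauchy–Schwarz. -/
theorem eq_of_inner_sub_eq_zero {a b : EuclideanSpace ℝ (Fin n)} (ha : ‖a‖ = 1) (hb : ‖b‖ = 1)
    (h : inner ℝ (a - b) a = 0) : b = a := by
  rw [inner_sub_left, real_inner_self_eq_norm_sq, ha] at h
  exact (inner_eq_one_iff_of_norm_eq_one (𝕜 := ℝ) hb ha).1 (by linarith)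

namespace IsLimitPolygon

variable {k : ℕ} {x : ZMod k → M} {e : ZMod k → EuclideanSpace ℝ (Fin n)}

/-- At `x i` the vector `e i` is tangent while `e i - e (i - 1)` is normal. -/
theorem pred_eq (h : IsLimitPolygon (m := m) f x e) {i : ZMod k} (hi : x i = x (i + 1)) :
    e (i - 1) = e i :=
  eq_of_inner_sub_eq_zero (h.norm_eq_one _) (h.norm_eq_one _)
    (h.reflection i _ (h.mem_tangentDirections i hi))

theorem succ_eq (h : IsLimitPolygon (m := m) f x e) {i : ZMod k} (hi : x i = x (i + 1)) :
    e (i + 1) = e i := by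
  have h1 := h.reflection (i + 1) (e i) (hi ▸ h.mem_tangentDirections i hi)
  rw [add_sub_cancel_right] at h1
  refine eq_of_inner_sub_eq_zero (h.norm_eq_one _) (h.norm_eq_one _) ?_
  rw [← neg_sub, inner_neg_left, h1, neg_zero]

theorem isClosedTrajectory (h : IsLimitPolygon (m := m) f x e) (hne : ∀ i, x i ≠ x (i + 1)) :
    IsClosedTrajectory (m := m) f x := by
  refine isClosedTrajectory_iff.2 ⟨hne, fun i a ha => ?_⟩
  have h1 := h.reflection i a ha
  have h2 := h.eq_direction (i - 1) (hne (i - 1))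
  rw [sub_add_cancel] at h2
  rwa [h.eq_direction i (hne i), h2] at h1

theorem rotate (h : IsLimitPolygon (m := m) f x e) (c : ZMod k) :
    IsLimitPolygon (m := m) f (fun i => x (i + c)) (fun i => e (i + c)) where
  norm_eq_one i := h.norm_eq_one _
  eq_direction i hi := by
    rw [add_right_comm] at hi ⊢
    exact h.eq_direction _ hi
  mem_tangentDirections i hi := by
    rw [add_right_comm] at hi
    exact h.mem_tangentDirections _ hi
  reflection i a ha := by
    rw [sub_add_eq_add_sub]
    exact h.reflection _ a ha

end IsLimitPolygon

/-- Taking representatives commutes with the successor except at the wrap-around, where the larger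
cycle has the extra element `-1` between `-2` and `0`. -/
theorem natCast_val_succ {j : ℕ} (a : ZMod (j + 1)) :
    (((a + 1).val : ℕ) : ZMod (j + 2)) = (a.val : ZMod (j + 2)) + 1 ∨
      (a.val : ZMod (j + 2)) = -2 ∧ a + 1 = 0 := by
  rcases Nat.lt_or_ge (a.val + 1) (j + 1) with h | h
  · left
    have h1 : (a + 1).val = a.val + 1 := by
      have h2 : ((a.val + 1 : ℕ) : ZMod (j + 1)) = a + 1 := by simp
      rw [← h2, ZMod.val_natCast, Nat.mod_eq_of_lt h]
    rw [h1]
    push_cast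
    rfl
  · right
    have h1 : a.val = j := by
      have := ZMod.val_lt a
      omega
    constructor
    · rw [h1, eq_neg_iff_add_eq_zero]
      exact_mod_cast ZMod.natCast_self (j + 2)
    · have h2 : ((a.val + 1 : ℕ) : ZMod (j + 1)) = a + 1 := by simp
      rw [← h2, h1, ZMod.natCast_self]

/-- The last edge of a polygon can be deleted if it is collapsed. -/
theorem IsLimitPolygon.delete {j : ℕ} {x : ZMod (j + 2) → M}
    {e : ZMod (j + 2) → EuclideanSpace ℝ (Fin n)} (h : IsLimitPolygon (m := m) f x e)
    (hlast : x (-1) = x 0) (hex : ∃ i, x i ≠ x (i + 1)) :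
    ∃ (y : ZMod (j + 1) → M) (d : ZMod (j + 1) → EuclideanSpace ℝ (Fin n)),
      IsLimitPolygon (m := m) f y d ∧ (∃ i, y i ≠ y (i + 1)) ∧
        ∃ i, d (i - 1) = d i ∧ d i ∈ tangentDirections (m := m) f (y i) := by
  have hlast' : x (-1) = x (-1 + 1) := by rwa [neg_add_cancel]
  have hpred := h.pred_eq hlast'
  have hsucc := h.succ_eq hlast'
  rw [neg_add_cancel] at hsucc
  have hm2 : (-1 - 1 : ZMod (j + 2)) = -2 := by ring
  have hm1 : (-2 + 1 : ZMod (j + 2)) = -1 := by ring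
  rw [hm2] at hpred
  -- `c` omits only the label `-1`. At the wrap-around, `x (-1) = x 0` repairs successors and `e
  -- (-2) = e (-1)` repairs predecessors.
  let c : ZMod (j + 1) → ZMod (j + 2) := fun a => (a.val : ZMod (j + 2))
  have hc0 : c 0 = 0 := by simp [c]
  have hx : ∀ a, x (c (a + 1)) = x (c a + 1) := by
    intro a
    rcases natCast_val_succ a with h1 | ⟨h1, h2⟩
    · exact congrArg x h1
    · rw [h2, hc0]
      change _ = x ((a.val : ZMod (j + 2)) + 1)
      rw [h1, hm1, hlast]
  have he : ∀ a, e (c (a - 1)) = e (c a - 1) := by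
    intro a
    rcases natCast_val_succ (a - 1) with h1 | ⟨h1, h2⟩
    · rw [sub_add_cancel] at h1
      change _ = e ((a.val : ZMod (j + 2)) - 1)
      rw [h1, add_sub_cancel_right]
    · rw [sub_add_cancel] at h2
      change e (((a - 1).val : ZMod (j + 2))) = _
      rw [h1, h2, hc0, zero_sub, hpred]
  -- Vertex `0` inherits the deleted edge: its incoming direction is `e (-1)`, which equals `e 0`
  -- and is tangent there.
  refine ⟨fun a => x (c a), fun a => e (c a), ⟨fun i => h.norm_eq_one _, fun i hi => ?_,
    fun i hi => ?_, fun i a ha => ?_⟩, ?_, 0, ?_, ?_⟩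
  · rw [hx] at hi ⊢
    exact h.eq_direction _ hi
  · rw [hx] at hi
    exact h.mem_tangentDirections _ hi
  · rw [he]
    exact h.reflection _ a ha
  · obtain ⟨i, hi⟩ := hex
    have hlt : i.val < j + 1 := by
      refine lt_of_le_of_ne (Nat.le_of_lt_succ (ZMod.val_lt i)) fun h1 => hi ?_
      have h2 : i = -1 := by
        rw [← ZMod.natCast_zmod_val i, h1, eq_neg_iff_add_eq_zero]
        exact_mod_cast ZMod.natCast_self (j + 2)
      rw [h2]
      exact hlast'
    have hci : c (i.val : ZMod (j + 1)) = i := by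
      simp only [c]
      rw [ZMod.val_natCast, Nat.mod_eq_of_lt hlt, ZMod.natCast_zmod_val]
    refine ⟨(i.val : ZMod (j + 1)), ?_⟩
    change x (c _) ≠ x (c (_ + 1))
    rw [hx, hci]
    exact hi
  · change e (c (0 - 1)) = e (c 0)
    rw [he, hc0, zero_sub, hsucc]
  · simp only [hc0, hsucc]
    rw [← hlast]
    exact h.mem_tangentDirections _ hlast'

variable [IsManifold (𝓡 m) ∞ M]

/-- Induction on the number of vertices. Without collapsed edges the polygon is a degenerate
trajectory; otherwise deleting a collapsed edge again leaves a straight tangential vertex, possibly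
a different one. A single vertex has no noncollapsed edge. -/
theorem IsLimitPolygon.not_straight
    (hf : ContMDiff (𝓡 m) 𝓘(ℝ, EuclideanSpace ℝ (Fin n)) ∞ f)
    (hinj : Function.Injective f) {k : ℕ} (hgen : IsGenericUpTo (m := m) f k) :
    ∀ (j : ℕ), j + 1 ≤ k → ∀ {x : ZMod (j + 1) → M} {e : ZMod (j + 1) → EuclideanSpace ℝ (Fin n)},
      IsLimitPolygon (m := m) f x e → (∃ i, x i ≠ x (i + 1)) →
        ¬ ∃ i, e (i - 1) = e i ∧ e i ∈ tangentDirections (m := m) f (x i) := by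
  intro j
  induction j with
  | zero =>
    rintro - x e - ⟨i, hi⟩ -
    exact hi (congrArg x (Subsingleton.elim (α := Fin 1) _ _))
  | succ j ih =>
    rintro hj x e h hex ⟨i, hi, hti⟩
    by_cases hcol : ∀ i, x i ≠ x (i + 1)
    · have h1 := h.eq_direction (i - 1) (hcol (i - 1))
      rw [sub_add_cancel] at h1
      have h2 := h.eq_direction i (hcol i)
      rw [h1, h2] at hi
      rw [h2] at hti
      exact not_lengthIsMorse hf hinj (h.isClosedTrajectory hcol) i hi hti
        (hgen (j + 2) (by omega) hj)
    · push Not at hcol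
      obtain ⟨l, hl⟩ := hcol
      -- Rotation by `l + 1` moves the collapsed edge `l` to the label `-1`, where it can be
      -- deleted.
      have hex' : ∃ i, x (i + (l + 1)) ≠ x (i + 1 + (l + 1)) := by
        obtain ⟨i, hi⟩ := hex
        refine ⟨i - (l + 1), ?_⟩
        rwa [sub_add_cancel, add_right_comm, sub_add_cancel]
      obtain ⟨y, d, hyd, hy, hd⟩ := (h.rotate (l + 1)).delete
        (by simpa using hl) hex'
      exact ih (by omega) hyd hy hd

theorem IsLimitPolygon.forall_ne
    (hf : ContMDiff (𝓡 m) 𝓘(ℝ, EuclideanSpace ℝ (Fin n)) ∞ f)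
    (hinj : Function.Injective f) {k : ℕ} [NeZero k] (hgen : IsGenericUpTo (m := m) f k)
    {x : ZMod k → M} {e : ZMod k → EuclideanSpace ℝ (Fin n)}
    (h : IsLimitPolygon (m := m) f x e) (hex : ∃ i, x i ≠ x (i + 1)) (i : ZMod k) :
    x i ≠ x (i + 1) := by
  intro hi
  obtain ⟨j, rfl⟩ := Nat.exists_eq_succ_of_ne_zero (NeZero.ne k)
  exact IsLimitPolygon.not_straight hf hinj hgen j le_rfl h hex
    ⟨i, h.pred_eq hi, h.mem_tangentDirections i hi⟩

end LimitPolygons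

/-! ### Closedness of the set of trajectories -/

section Closedness

/-- Secant directions of a family of maps converge to tangent directions. -/
theorem mem_range_of_tendsto_direction {n : ℕ} {I V α : Type*} [TopologicalSpace I]
    [NormedAddCommGroup V] [NormedSpace ℝ V] [FiniteDimensional ℝ V]
    {G : I → V → EuclideanSpace ℝ (Fin n)} {G' : I × V → V →L[ℝ] EuclideanSpace ℝ (Fin n)}
    {t₀ : I} {u₀ : V} (hG : ∀ᶠ p in 𝓝 (t₀, u₀), HasFDerivAt (G p.1) (G' p) p.2)
    (hG' : ContinuousAt G' (t₀, u₀)) (hinj : Function.Injective (G' (t₀, u₀)))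
    {l : Filter α} [l.NeBot] {τ : α → I} {a b : α → V} {e : EuclideanSpace ℝ (Fin n)}
    (hτ : Tendsto τ l (𝓝 t₀)) (ha : Tendsto a l (𝓝 u₀)) (hb : Tendsto b l (𝓝 u₀))
    (hab : ∀ᶠ z in l, G (τ z) (a z) ≠ G (τ z) (b z))
    (he : Tendsto (fun z => direction (G (τ z) (a z)) (G (τ z) (b z))) l (𝓝 e)) :
    e ∈ range (G' (t₀, u₀)) := by
  set A := G' (t₀, u₀)
  obtain ⟨C, hC, hanti⟩ := (A : V →ₗ[ℝ] EuclideanSpace ℝ (Fin n)).exists_antilipschitzWith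
    (LinearMap.ker_eq_bot.2 hinj)
  have hclosed : IsClosed (range A) := by
    have := (LinearMap.range (A : V →ₗ[ℝ] EuclideanSpace ℝ (Fin n))).closed_of_finiteDimensional
    exact this
  rw [← hclosed.closure_eq, Metric.mem_closure_iff]
  intro ε hε
  have hC' : (0 : ℝ) < C := NNReal.coe_pos.2 hC
  -- The first bound absorbs the linearisation error into the lower bound for `A`, giving `‖w‖ ≤ 2 *
  -- C * ‖y‖`; the second then places the secant direction within `ε / 2` of the range.
  obtain ⟨c, hc, hcC, hcε⟩ : ∃ c : ℝ≥0, 0 < c ∧ (c : ℝ) * C ≤ 1 / 2 ∧ c * (2 * C) ≤ ε / 2 := by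
    have hpos : 0 < min (1 / 2 / (C : ℝ)) (ε / 2 / (2 * C)) :=
      lt_min (by positivity) (by positivity)
    refine ⟨Real.toNNReal _, Real.toNNReal_pos.2 hpos, ?_, ?_⟩ <;>
      rw [Real.coe_toNNReal _ hpos.le]
    · exact (le_div_iff₀ hC').1 (min_le_left _ _)
    · exact (le_div_iff₀ (by positivity)).1 (min_le_right _ _)
  obtain ⟨r, happrox, hr⟩ := ((eventually_approximatesLinearOn hG hG' hc).and
    self_mem_nhdsWithin).exists
  have hball := closedBall_mem_nhds u₀ hr
  obtain ⟨z, hz, haz, hbz, hne, hez⟩ := ((hτ.eventually happrox).and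
    ((ha.eventually hball).and ((hb.eventually hball).and
      (hab.and (he.eventually (ball_mem_nhds e (half_pos hε))))))).exists
  have h1 : ‖G (τ z) (a z) - G (τ z) (b z) - A (a z - b z)‖ ≤ c * ‖a z - b z‖ :=
    hz _ haz _ hbz
  set y := G (τ z) (a z) - G (τ z) (b z)
  set w := a z - b z
  have hy : 0 < ‖y‖ := norm_pos_iff.2 (sub_ne_zero.2 hne)
  have h2 : ‖w‖ ≤ C * ‖A w‖ := by
    have := hanti.le_mul_dist w 0
    simpa using this
  have h3 : ‖A w‖ ≤ ‖y‖ + c * ‖w‖ := by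
    have := norm_sub_norm_le (A w) y
    rw [norm_sub_rev (A w) y] at this
    linarith
  have h4 : ‖w‖ ≤ 2 * C * ‖y‖ := by
    have h5 : (C : ℝ) * ‖A w‖ ≤ C * ‖y‖ + c * C * ‖w‖ := by nlinarith
    have h6 : (c : ℝ) * C * ‖w‖ ≤ 1 / 2 * ‖w‖ := by gcongr
    linarith
  refine ⟨A (‖y‖⁻¹ • w), mem_range_self _, ?_⟩
  have h5 : dist (direction (G (τ z) (a z)) (G (τ z) (b z))) (A (‖y‖⁻¹ • w)) ≤ ε / 2 := by
    rw [dist_eq_norm, map_smul, direction, ← smul_sub, norm_smul, norm_inv, norm_norm]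
    rw [inv_mul_le_iff₀ hy]
    calc ‖y - A w‖ ≤ c * ‖w‖ := h1
      _ ≤ c * (2 * C * ‖y‖) := by gcongr
      _ = c * (2 * C) * ‖y‖ := by ring
      _ ≤ ε / 2 * ‖y‖ := by gcongr
      _ = ‖y‖ * (ε / 2) := by ring
  calc dist e (A (‖y‖⁻¹ • w)) ≤ dist e _ + dist _ _ := dist_triangle _ _ _
    _ < ε / 2 + ε / 2 := add_lt_add_of_lt_of_le (by rw [dist_comm]; exact hez) h5
    _ = ε := add_halves ε

variable {n m : ℕ} {M : Type*} [TopologicalSpace M]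
  [ChartedSpace (EuclideanSpace ℝ (Fin m)) M] [IsManifold (𝓡 m) ∞ M]
  {F : M × unitInterval → EuclideanSpace ℝ (Fin n)}
  {α : Type*} {l : Filter α} {τ : α → unitInterval} {t₀ : unitInterval}

theorem mem_tangentDirections_of_tendsto [l.NeBot]
    (hF : ContMDiff ((𝓡 m).prod (𝓡∂ 1)) 𝓘(ℝ, EuclideanSpace ℝ (Fin n)) ∞ F) {p : M}
    (himm : Function.Injective (mfderiv (𝓡 m) 𝓘(ℝ, EuclideanSpace ℝ (Fin n))
      (fun p : M => F (p, t₀)) p))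
    {a b : α → M} {e : EuclideanSpace ℝ (Fin n)} (hτ : Tendsto τ l (𝓝 t₀))
    (ha : Tendsto a l (𝓝 p)) (hb : Tendsto b l (𝓝 p))
    (hab : ∀ᶠ z in l, F (a z, τ z) ≠ F (b z, τ z))
    (he : Tendsto (fun z => direction (F (a z, τ z)) (F (b z, τ z))) l (𝓝 e)) :
    e ∈ tangentDirections (m := m) (fun p => F (p, t₀)) p := by
  set φ := extChartAt (𝓡 m) p
  let G : unitInterval → EuclideanSpace ℝ (Fin m) → EuclideanSpace ℝ (Fin n) := fun t u =>
    F (φ.symm u, t)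
  have hφp : φ.symm (φ p) = p := extChartAt_to_inv p
  have hmem : φ p ∈ φ.target := mem_extChartAt_target p
  have hG : ∀ᶠ q in 𝓝 (t₀, φ p), HasFDerivAt (G q.1) (fderiv ℝ (G q.1) q.2) q.2 := by
    have hc : ContinuousAt (fun q : unitInterval × EuclideanSpace ℝ (Fin m) => q.2)
      (t₀, φ p) := continuousAt_snd
    filter_upwards [hc.eventually ((isOpen_extChartAt_target p).mem_nhds hmem)] with q hq
    exact (differentiableAt_slice_of_contMDiffAt (L := G)
      (contMDiffAt_comp_extChartAt_symm hF hq)).hasFDerivAt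
  have hG' : ContinuousAt (fun q : unitInterval × EuclideanSpace ℝ (Fin m) =>
      fderiv ℝ (G q.1) q.2) (t₀, φ p) :=
    (contMDiffAt_partial_fderiv (L := G)
      (contMDiffAt_comp_extChartAt_symm hF (q := (t₀, φ p)) hmem)).continuousAt
  have hrange := range_fderiv_comp_extChartAt_symm (f := fun p : M => F (p, t₀)) hmem
    (mdifferentiable_slice hF t₀ _)
  rw [hφp] at hrange
  have hfd : fderiv ℝ (G t₀) (φ p) = mfderiv (𝓡 m) 𝓘(ℝ, EuclideanSpace ℝ (Fin n))
      (fun p : M => F (p, t₀)) p := by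
    rw [(mdifferentiable_slice hF t₀ p).mfderiv]
    simp only [mfld_simps, fderivWithin_univ]
    rfl
  rw [← hrange]
  have hsrc : φ.source ∈ 𝓝 p := extChartAt_source_mem_nhds p
  have hinva : ∀ᶠ z in l, φ.symm (φ (a z)) = a z :=
    (ha.eventually hsrc).mono fun z hz => φ.left_inv hz
  have hinvb : ∀ᶠ z in l, φ.symm (φ (b z)) = b z :=
    (hb.eventually hsrc).mono fun z hz => φ.left_inv hz
  refine mem_range_of_tendsto_direction hG hG' ?_ hτ
    ((continuousAt_extChartAt (I := 𝓡 m) p).tendsto.comp ha)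
    ((continuousAt_extChartAt (I := 𝓡 m) p).tendsto.comp hb) ?_ (he.congr' ?_)
  · change Function.Injective (fderiv ℝ (G t₀) (φ p))
    rw [hfd]
    exact himm
  · filter_upwards [hab, hinva, hinvb] with z hz hza hzb
    change F (φ.symm (φ (a z)), τ z) ≠ F (φ.symm (φ (b z)), τ z)
    rwa [hza, hzb]
  · filter_upwards [hinva, hinvb] with z hza hzb
    change _ = direction (F (φ.symm (φ (a z)), τ z)) (F (φ.symm (φ (b z)), τ z))
    rw [hza, hzb]

/-- A tangent vector at the limit is the limit of the tangent vectors with the same chart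
coordinates at the nearby points. -/
theorem inner_eq_zero_of_tendsto [l.NeBot]
    (hF : ContMDiff ((𝓡 m).prod (𝓡∂ 1)) 𝓘(ℝ, EuclideanSpace ℝ (Fin n)) ∞ F) {p : M}
    {a : α → M} {d : α → EuclideanSpace ℝ (Fin n)} {e : EuclideanSpace ℝ (Fin n)}
    (hτ : Tendsto τ l (𝓝 t₀)) (ha : Tendsto a l (𝓝 p)) (hd : Tendsto d l (𝓝 e))
    (horth : ∀ᶠ z in l, ∀ v ∈ tangentDirections (m := m) (fun p => F (p, τ z)) (a z),
      inner ℝ (d z) v = 0) :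
    ∀ v ∈ tangentDirections (m := m) (fun p => F (p, t₀)) p, inner ℝ e v = 0 := by
  set φ := extChartAt (𝓡 m) p
  let G : unitInterval → EuclideanSpace ℝ (Fin m) → EuclideanSpace ℝ (Fin n) := fun t u =>
    F (φ.symm u, t)
  have hφp : φ.symm (φ p) = p := extChartAt_to_inv p
  have hmem : φ p ∈ φ.target := mem_extChartAt_target p
  have hG' : ContinuousAt (fun q : unitInterval × EuclideanSpace ℝ (Fin m) =>
      fderiv ℝ (G q.1) q.2) (t₀, φ p) :=
    (contMDiffAt_partial_fderiv (L := G)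
      (contMDiffAt_comp_extChartAt_symm hF (q := (t₀, φ p)) hmem)).continuousAt
  have hrange := range_fderiv_comp_extChartAt_symm (f := fun p : M => F (p, t₀)) hmem
    (mdifferentiable_slice hF t₀ _)
  rw [hφp] at hrange
  rw [← hrange]
  rintro _ ⟨w, rfl⟩
  have hq : Tendsto (fun z => (τ z, φ (a z))) l (𝓝 (t₀, φ p)) :=
    hτ.prodMk_nhds ((continuousAt_extChartAt (I := 𝓡 m) p).tendsto.comp ha)
  have hA : Tendsto (fun z => fderiv ℝ (G (τ z)) (φ (a z))) l (𝓝 (fderiv ℝ (G t₀) (φ p))) :=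
    hG'.tendsto.comp hq
  have hlim : Tendsto (fun z => inner ℝ (d z) (fderiv ℝ (G (τ z)) (φ (a z)) w)) l
      (𝓝 (inner ℝ e (fderiv ℝ (G t₀) (φ p) w))) :=
    hd.inner (((ContinuousLinearMap.apply ℝ _ w).continuous.tendsto _).comp hA)
  refine tendsto_nhds_unique hlim (tendsto_const_nhds.congr' ?_)
  have hsrc : φ.source ∈ 𝓝 p := extChartAt_source_mem_nhds p
  filter_upwards [horth, ha.eventually hsrc] with z hz hza
  have hrangez := range_fderiv_comp_extChartAt_symm (f := fun p : M => F (p, τ z))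
    (φ.map_source hza) (mdifferentiable_slice hF (τ z) _)
  rw [φ.left_inv hza] at hrangez
  rw [← hrangez] at hz
  exact (hz _ (mem_range_self w)).symm

theorem isClosed_trajectories
    (hF : ContMDiff ((𝓡 m).prod (𝓡∂ 1)) 𝓘(ℝ, EuclideanSpace ℝ (Fin n)) ∞ F)
    (hinj : ∀ t, Function.Injective fun p : M => F (p, t))
    (himm : ∀ t p, Function.Injective (mfderiv (𝓡 m) 𝓘(ℝ, EuclideanSpace ℝ (Fin n))
      (fun p : M => F (p, t)) p)) {k : ℕ} [NeZero k]
    (hgen : ∀ t : unitInterval, IsGenericUpTo (m := m) (fun p : M => F (p, t)) k) :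
    IsClosed {q : (ZMod k → M) × unitInterval |
      q.1 ∈ trajectories (m := m) (fun p => F (p, q.2)) k} := by
  rw [isClosed_iff_ultrafilter]
  rintro ⟨x, t⟩ u hu hT
  have hx : ∀ i, Tendsto (fun q : (ZMod k → M) × unitInterval => q.1 i) u (𝓝 (x i)) := fun i =>
    (((continuous_apply i).comp continuous_fst).tendsto (x, t)).mono_left hu
  have hτ : Tendsto (fun q : (ZMod k → M) × unitInterval => q.2) u (𝓝 t) :=
    (continuous_snd.tendsto (x, t)).mono_left hu
  have hv : ∀ i, Tendsto (fun q : (ZMod k → M) × unitInterval => F (q.1 i, q.2)) u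
      (𝓝 (F (x i, t))) := fun i =>
    (hF.continuous.tendsto (x i, t)).comp ((hx i).prodMk_nhds hτ)
  let d : (ZMod k → M) × unitInterval → ZMod k → EuclideanSpace ℝ (Fin n) := fun q i =>
    direction (F (q.1 i, q.2)) (F (q.1 (i + 1), q.2))
  have hd : ∀ q, d q ∈ closedBall (0 : ZMod k → EuclideanSpace ℝ (Fin n)) 1 := fun q => by
    rw [mem_closedBall_zero_iff, pi_norm_le_iff_of_nonneg zero_le_one]
    exact fun i => norm_direction_le _ _
  -- Compactness of the unit ball makes all edge directions converge along the ultrafilter, without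
  -- passing to subsequences.
  obtain ⟨e, -, he⟩ := (isCompact_iff_ultrafilter_le_nhds.1
    (isCompact_closedBall (0 : ZMod k → EuclideanSpace ℝ (Fin n)) 1)) (u.map d)
    (le_principal_iff.2 (mem_map.2 (univ_mem' hd)))
  have hlim : ∀ i, Tendsto (fun q => d q i) u (𝓝 (e i)) := fun i =>
    ((continuous_apply i).tendsto e).comp he
  have hne : ∀ᶠ q in (u : Filter ((ZMod k → M) × unitInterval)), ∀ i,
      F (q.1 i, q.2) ≠ F (q.1 (i + 1), q.2) := by
    filter_upwards [hT] with q hq i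
    exact (hinj q.2).ne (hq.1 i)
  have horth : ∀ i, ∀ᶠ q in (u : Filter ((ZMod k → M) × unitInterval)),
      ∀ v ∈ tangentDirections (m := m) (fun p => F (p, q.2)) (q.1 i),
        inner ℝ (d q i - d q (i - 1)) v = 0 := by
    intro i
    filter_upwards [hT] with q hq
    have hq' : IsClosedTrajectory (m := m) (fun p => F (p, q.2)) q.1 := hq
    simp only [d, sub_add_cancel]
    exact (isClosedTrajectory_iff.1 hq').2 i
  have hpoly : IsLimitPolygon (m := m) (fun p => F (p, t)) x e := by
    refine ⟨fun i => ?_, fun i hi => ?_, fun i hi => ?_, fun i => ?_⟩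
    · refine tendsto_nhds_unique (hlim i).norm (tendsto_const_nhds.congr' ?_)
      filter_upwards [hne] with q hq
      exact (norm_direction (hq i)).symm
    · refine tendsto_nhds_unique (hlim i) ?_
      have hsub := (hv i).sub (hv (i + 1))
      exact (hsub.norm.inv₀ (norm_ne_zero_iff.2 (sub_ne_zero.2 ((hinj t).ne hi)))).smul hsub
    · exact mem_tangentDirections_of_tendsto hF (himm t _) hτ (hx i) (hi ▸ hx (i + 1))
        (hne.mono fun q hq => hq i) (hlim i)
    · exact inner_eq_zero_of_tendsto hF (d := fun q => d q i - d q (i - 1)) hτ (hx i)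
        ((hlim i).sub (hlim (i - 1))) (horth i)
  refine hpoly.isClosedTrajectory (hpoly.forall_ne (contMDiff_slice hF t) (hinj t) (hgen t) ?_)
  -- Total collapse: all limit directions equal `e 0`, so nearby polygons have every edge at
  -- positive inner product with `e 0`, although their edge vectors sum to zero.
  by_contra! hcol
  have hconst : ∀ i, e i = e 0 := by
    have h1 : ∀ j : ℕ, e (j : ZMod k) = e 0 := by
      intro j
      induction j with
      | zero => simp
      | succ j ih => rw [Nat.cast_succ, hpoly.succ_eq (hcol _), ih]
    intro i
    rw [← ZMod.natCast_zmod_val i]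
    exact h1 _
  have hpos : ∀ i, ∀ᶠ q in (u : Filter ((ZMod k → M) × unitInterval)),
      0 < inner ℝ (d q i) (e 0) := by
    intro i
    have h1 : Tendsto (fun q => inner ℝ (d q i) (e 0)) u (𝓝 (inner ℝ (e i) (e 0))) :=
      (hlim i).inner tendsto_const_nhds
    refine h1.eventually (lt_mem_nhds ?_)
    rw [hconst i, real_inner_self_eq_norm_sq, hpoly.norm_eq_one]
    norm_num
  obtain ⟨q, hq, hqpos⟩ := (hne.and (eventually_all.2 hpos)).exists
  have hsum : ∑ i, (F (q.1 i, q.2) - F (q.1 (i + 1), q.2)) = 0 := by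
    rw [Finset.sum_sub_distrib, sub_eq_zero]
    exact (Equiv.sum_comp (Equiv.addRight (1 : ZMod k)) fun i => F (q.1 i, q.2)).symm
  have hsum' : ∑ i, ‖F (q.1 i, q.2) - F (q.1 (i + 1), q.2)‖ * inner ℝ (d q i) (e 0) = 0 := by
    rw [← inner_zero_left (𝕜 := ℝ) (e 0), ← hsum, sum_inner]
    refine Finset.sum_congr rfl fun i _ => ?_
    rw [← real_inner_smul_left, norm_smul_direction]
  refine (Finset.sum_pos (fun i _ => ?_) Finset.univ_nonempty).ne' hsum'
  exact mul_pos (norm_pos_iff.2 (sub_ne_zero.2 (hq i))) (hqpos i)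

end Closedness

/-! ### Dihedral symmetries -/

section Dihedral

variable {n m : ℕ} {M : Type*} [TopologicalSpace M]
  [ChartedSpace (EuclideanSpace ℝ (Fin m)) M]

/-- The rotations and reflections of the labels of a polygon. -/
def dihedralMap {M : Type*} {k : ℕ} (g : ZMod k × Bool) (x : ZMod k → M) : ZMod k → M :=
  fun i => if g.2 then x (g.1 - i) else x (g.1 + i)

theorem continuous_dihedralMap {k : ℕ} (g : ZMod k × Bool) :
    Continuous (dihedralMap (M := M) g) := by
  refine continuous_pi fun i => ?_
  unfold dihedralMap
  split_ifs <;> exact continuous_apply _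

theorem dihedralSetoid_iff {M : Type*} {k : ℕ} (x y : ZMod k → M) :
    dihedralSetoid k M x y ↔ ∃ g, y = dihedralMap g x := by
  constructor
  · rintro ⟨c, h | h⟩
    · exact ⟨(c, false), funext fun i => by simp [dihedralMap, h]⟩
    · exact ⟨(c, true), funext fun i => by simp [dihedralMap, h]⟩
  · rintro ⟨⟨c, b⟩, rfl⟩
    cases b
    · exact ⟨c, Or.inl fun i => by simp [dihedralMap]⟩
    · exact ⟨c, Or.inr fun i => by simp [dihedralMap]⟩

theorem direction_swap (p q : EuclideanSpace ℝ (Fin n)) : direction p q = -direction q p := by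
  rw [direction, direction, norm_sub_rev, ← smul_neg, neg_sub]

/-- Reversal exchanges the two edges at a vertex and negates both directions, so the difference in
the reflection law is unchanged. -/
theorem dihedralMap_mem_trajectories {f : M → EuclideanSpace ℝ (Fin n)} {k : ℕ}
    (g : ZMod k × Bool) {x : ZMod k → M} (hx : x ∈ trajectories (m := m) f k) :
    dihedralMap g x ∈ trajectories (m := m) f k := by
  obtain ⟨c, b⟩ := g
  obtain ⟨hne, href⟩ := isClosedTrajectory_iff.1 hx
  refine isClosedTrajectory_iff.2 ?_
  cases b
  · simp only [dihedralMap, Bool.false_eq_true, if_false]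
    refine ⟨fun i => ?_, fun i a ha => ?_⟩
    · rw [← add_assoc]
      exact hne _
    · rw [← add_assoc, ← add_sub_assoc]
      exact href _ a ha
  · simp only [dihedralMap, if_true]
    have h1 : ∀ i, c - i = c - (i + 1) + 1 := fun i => by ring
    refine ⟨fun i => ?_, fun i a ha => ?_⟩
    · rw [h1 i]
      exact (hne _).symm
    · have h2 := href (c - i) a ha
      have h3 : c - i - 1 = c - (i + 1) := by ring
      have h4 : c - i + 1 = c - (i - 1) := by ring
      rw [h3, h4] at h2
      rw [direction_swap (f (x (c - i))), direction_swap (f (x (c - (i - 1)))), neg_sub_neg]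
      exact h2

end Dihedral

end Billiard

end

end

theorem mainTheorem2 {n m : ℕ} {M : Type*} [TopologicalSpace M] [T2Space M] [CompactSpace M]
    [ChartedSpace (EuclideanSpace ℝ (Fin m)) M] [IsManifold (𝓡 m) ∞ M]
    (F : M × unitInterval → EuclideanSpace ℝ (Fin n))
    (hF : ContMDiff ((𝓡 m).prod (𝓡∂ 1)) 𝓘(ℝ, EuclideanSpace ℝ (Fin n)) ∞ F)
    (k : ℕ) (hk : 2 ≤ k)
    (hemb : ∀ t : unitInterval, Manifold.IsSmoothEmbedding (𝓡 m)
      𝓘(ℝ, EuclideanSpace ℝ (Fin n)) ∞ fun p : M => F (p, t))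
    (hgen : ∀ t : unitInterval, Billiard.IsGenericUpTo (m := m) (fun p : M => F (p, t)) k) :
    (∀ t : unitInterval, (Billiard.trajectories (m := m) (fun p : M => F (p, t)) k).Finite) ∧
    ∀ s t : unitInterval,
      (Billiard.trajectories (m := m) (fun p : M => F (p, s)) k).ncard =
        (Billiard.trajectories (m := m) (fun p : M => F (p, t)) k).ncard ∧
      (Billiard.unlabelledTrajectories (m := m) (fun p : M => F (p, s)) k).ncard =
        (Billiard.unlabelledTrajectories (m := m) (fun p : M => F (p, t)) k).ncard := by
  have : NeZero k := ⟨by omega⟩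
  have hinj : ∀ t, Function.Injective fun p : M => F (p, t) := fun t =>
    (hemb t).isEmbedding.injective
  have hclosed := Billiard.isClosed_trajectories hF hinj
    (fun t p => Billiard.injective_mfderiv_of_isImmersionAt ((hemb t).isImmersion.isImmersionAt p))
    hgen
  have hnd : ∀ t, ∀ x ∈ Billiard.trajectories (m := m) (fun p : M => F (p, t)) k,
      Billiard.HasNondegenerateHessian (m := m) (fun p : M => F (p, t)) x := fun t x hx =>
    hgen t k hk le_rfl x hx.1
      ((Billiard.isCriticalPoint_iff (Billiard.mdifferentiable_slice hF t) (hinj t) hx.1).2 hx)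
  have huniq : ∀ t₀, ∀ x ∈ Billiard.trajectories (m := m) (fun p : M => F (p, t₀)) k,
      ∃ U ∈ nhds x, ∀ᶠ t in nhds t₀,
        (U ∩ Billiard.trajectories (m := m) (fun p : M => F (p, t)) k).Subsingleton :=
    fun t₀ x hx => Billiard.eventually_subsingleton_trajectories hF hinj hx.1 (hnd t₀ x hx)
  refine ⟨fun t => ?_, ?_⟩
  · exact Billiard.finite_fibre
      (T := fun t => Billiard.trajectories (m := m) (fun p : M => F (p, t)) k) hclosed t
      fun x hx => let ⟨U, hU, h⟩ := huniq t x hx; ⟨U, hU, h.self_of_nhds⟩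
  · exact Billiard.ncard_fibre_eq
      (T := fun t => Billiard.trajectories (m := m) (fun p : M => F (p, t)) k)
      Billiard.dihedralMap Billiard.continuous_dihedralMap
      (fun g t x hx => Billiard.dihedralMap_mem_trajectories g hx) (Billiard.dihedralSetoid k M)
      Billiard.dihedralSetoid_iff hclosed huniq
      fun t₀ x hx U hU => Billiard.eventually_nonempty_trajectories hF hinj hx (hnd t₀ x hx) hU
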